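/- **Model.** Fix $r\ge 1$ and a probability vector $\mu=(\mu_1,\dots,\mu_r)$ with $\mu_i>0$ and $\sum_i\mu_i=1$, neither depending on $n$. Given integers $K_1\le\dots\le K_r\le P$ and $\alpha\in(0,1)$, the inhomogeneous random key graph $\mathbb K(n;\mu,K,P)$ has nodes $v_1,\dots,v_n$; independently for each node, $v_x$ has class $i$ with probability $\mu_i$ and, given class $i$, receives a key ring $\Sigma_x$ that is uniform among the $K_i$-element subsets of $\{1,\dots,P\}$; distinct nodes $v_x,v_y$ are adjacent iff $\Sigma_x\cap\Sigma_y\ne\emptyset$. Let $\mathbb G(n;\alpha)$ be an independent Erdős–Rényi graph on the same nodes, in which each pair is adjacent independently with probability $\alpha$. Let $\mathbb H(n;\mu,\Theta)$, with $\Theta=(K_1,\dots,K_r,P,\alpha)$, be their intersection: two nodes are adjacent iff they are adjacent in both graphs. Put $$p_{ij}=1-\binom{P-K_i}{K_j}\Big/\binom{P}{K_j}\ \ (p_{ij}=1\text{ if }K_i+K_j>P),\qquad \lambda_i=\sum_{j=1}^r p_{ij}\mu_j .$$ **Theorem 1.** Let $n\mapsto\Theta_n=(K_{1,n},\dots,K_{r,n},P_n,\alpha_n)$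 be a sequence of parameters, with integers $K_{i,n},P_n$ and $\alpha_n\in(0,1)$, such that $$2\le K_{1,n}\le K_{2,n}\le\dots\le K_{r,n}\le P_n/2\qquad\text{for all } n\ge 2,$$ and let $\lambda_1(n)$ be the value of $\lambda_1$ at $\Theta_n$. Let $k\ge 0$ be an integer, and let the real sequence $\gamma_n$ be defined through $$\alpha_n\lambda_1(n)=\frac{\log n+(k-1)\log\log n+\gamma_n}{n},\qquad n\ge 2 .$$ (a) If $k\ge 1$, $\lambda_1(n)=o(1)$ and $\lim_{n\to\infty}\gamma_n=-\infty$, then $$\lim_{n\to\infty}\mathbb P[\text{minimum node degree of }\mathbb H(n;\mu,\Theta_n)\ge k]=0 .$$ (b) If $\lim_{n\to\infty}\gamma_n=+\infty$, then $$\lim_{n\to\infty}\mathbb P[\text{minimum node degree of }\mathbb H(n;\mu,\Theta_n)\ge k]=1 .$$ -/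

import Mathlib

open MeasureTheory ProbabilityTheory Filter Topology

noncomputable section

namespace HeteroKeyGraph

/-- The joint law of the class `t` and the key ring `Σ` of a single node: the class is `i` with
probability `μ i` and, given class `i`, the key ring is uniform among the subsets of cardinality
`K i` of the key pool, which is `Fin P`. -/
def nodeLaw {r : ℕ} (μ : Fin r → ℝ) (K : Fin r → ℕ) (P : ℕ) :
    Measure (Fin r × Finset (Fin P)) :=
  ∑ i, ENNReal.ofReal (μ i) •
    (Measure.dirac i).prod (uniformOn {S : Finset (Fin P) | S.card = K i})

/-- The graph on `n` nodes carrying classes and key rings `s`, in which two distinct nodes are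
adjacent when their key rings have a common key. -/
def keyGraph {n r P : ℕ} (s : Fin n → Fin r × Finset (Fin P)) : SimpleGraph (Fin n) where
  Adj x y := x ≠ y ∧ ((s x).2 ∩ (s y).2).Nonempty
  symm := ⟨fun x y h => ⟨h.1.symm, by rw [Finset.inter_comm]; exact h.2⟩⟩
  loopless := ⟨fun _ h => h.1 rfl⟩

/-- The probability space of the model: the `n` nodes receive independent pairs
(class, key ring) with law `nodeLaw μ K P`, and, independently of them, a binomial (Erdős–Rényi)
random graph with edge probability `α` is drawn on the nodes. -/
def modelMeasure (n : ℕ) {r : ℕ} (μ : Fin r → ℝ) (K : Fin r → ℕ) (P : ℕ) (α : unitInterval) :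
    Measure ((Fin n → Fin r × Finset (Fin P)) × SimpleGraph (Fin n)) :=
  (Measure.pi fun _ : Fin n => nodeLaw μ K P).prod (SimpleGraph.binomialRandom (Fin n) α)

/-- The intersection of the key graph and the channel graph, as a function on the probability
space: under `modelMeasure n μ K P α` this is the random graph `ℍ(n; μ, K, P, α)`. -/
def interGraph {n r P : ℕ} (ω : (Fin n → Fin r × Finset (Fin P)) × SimpleGraph (Fin n)) :
    SimpleGraph (Fin n) :=
  keyGraph ω.1 ⊓ ω.2

open Classical in
/-- The probability that the minimum node degree of `ℍ(n; μ, K, P, α)` is at least `k`. -/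
def probMinDegreeGE (n : ℕ) {r : ℕ} (μ : Fin r → ℝ) (K : Fin r → ℕ) (P : ℕ) (α : unitInterval)
    (k : ℕ) : ℝ :=
  (modelMeasure n μ K P α).real {ω | k ≤ (interGraph ω).minDegree}

/-- The probability that two nodes with `a` and `b` keys from a pool of size `P` share a key,
`1 - C(P - a, b) / C(P, b)`. For `a + b > P` (and `0 < b`) the truncated subtraction makes the
first binomial coefficient zero, so that the value is `1`, as it should be. -/
def shareProb (P a b : ℕ) : ℝ :=
  1 - ((P - a).choose b : ℝ) / (P.choose b : ℝ)

/-- The mean edge probability `λ_i = ∑ j, p_{ij} μ_j` of a class-`i` node in the key graph. -/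
def meanEdgeProb {r : ℕ} (μ : Fin r → ℝ) (K : Fin r → ℕ) (P : ℕ) (i : Fin r) : ℝ :=
  ∑ j, shareProb P (K i) (K j) * μ j

end HeteroKeyGraph

end

noncomputable section

namespace HeteroKeyGraph

/-! Given its own data, a node of class i has a binomial degree with parameters n - 1 and αλ_i,
because the other nodes attach to it independently.

Part (b) is the first moment method. Ring sizes increase with the class, so λ_1 is the smallest λ_i.
For any q ≥ αλ_1, n times the lower tail of the binomial law is at most a function of the excess of
nq over log n + (k-1) log log n alone, and this function vanishes at infinity (`mul_binomialLT_le`,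
`le_probMinDegreeGE`).

Part (a) is the second moment method for the nodes of class 1 with degree below k. Their mean number
diverges (`min_le_mul_binomialLT`), so it remains to see that pairs are asymptotically uncorrelated.
Put q = αλ_1. For two nodes with rings A and B let b be the probability that a third node is
adjacent to both. The joint probability exceeds the product by at most the factor
`correlationBound`, which tends to 1 when nb and q tend to 0 and otherwise grows about like exp(nb)
(`joint_le_correlationBound_mul`). Pairs are sorted by the overlap of A and B
(`modelMeasure_real_inter_le_correlationBound`). Disjoint rings give b = O(q²), hence a factor
tending to 1. One common key has probability O(λ_1) and gives b ≤ αq/2 + O(q²), where the half is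
due to rings having at least two keys. Two or more common keys have probability O(λ_1²), and b ≤ αq.

The overlapping pairs are negligible (`correlation_remainder_le`): if α log n ≤ 1, then nb is
bounded and λ_1 → 0 suffices; otherwise λ_1 = O((log n)²/n), which beats exp(nb) thanks to the half
above. -/

/-! ### Factorisation of the adjacency pattern around a set of roots. -/

instance discreteMeasurableSpace_simpleGraph (n : ℕ) :
    DiscreteMeasurableSpace (SimpleGraph (Fin n)) := by
  have : MeasurableSingletonClass (SimpleGraph (Fin n)) := by
    refine ⟨fun G => ?_⟩
    have h := SimpleGraph.measurable_edgeSet (V := Fin n) (measurableSet_singleton G.edgeSet)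
    convert h using 1
    ext H
    simp
  infer_instance

open Classical in
/-- The mass that a Bernoulli variable with parameter `p` gives to a set of truth values. -/
def bernoulliMass (p : ℝ) (B : Set Prop) : ℝ :=
  (if True ∈ B then p else 0) + (if False ∈ B then 1 - p else 0)

/-- The random graph is the image of a product of Bernoulli measures under
`SimpleGraph.fromEdgeSet`, so the preimage of a cylinder event is a box. Diagonal pairs are excluded
because `fromEdgeSet` deletes them. -/
lemma binomialRandom_real_box {n : ℕ} (p : unitInterval) (A : Finset (Sym2 (Fin n)))
    (hA : ∀ e ∈ A, ¬ e.IsDiag) (B : Sym2 (Fin n) → Set Prop) :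
    (SimpleGraph.binomialRandom (Fin n) p).real {G | ∀ e ∈ A, (e ∈ G.edgeSet) ∈ B e} =
      ∏ e ∈ A, bernoulliMass p (B e) := by
  classical
  rw [measureReal_def, SimpleGraph.binomialRandom_eq_map,
    Measure.map_apply SimpleGraph.measurable_fromEdgeSet .of_discrete, setBernoulli_apply']
  have : ((fun q : Sym2 (Fin n) → Prop => {i | q i}) ⁻¹' (SimpleGraph.fromEdgeSet ⁻¹'
      {G : SimpleGraph (Fin n) | ∀ e ∈ A, (e ∈ G.edgeSet) ∈ B e})) = Set.pi A B := by
    ext q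
    simp only [Set.mem_preimage, Set.mem_ofPred_eq, SimpleGraph.edgeSet_fromEdgeSet, Set.mem_pi,
      Finset.mem_coe]
    refine forall₂_congr fun e he => ?_
    have h : (e ∈ ({i | q i} \ Sym2.diagSet)) = q e := by simp [hA e he]
    rw [h]
  rw [this, Measure.infinitePi_pi _ (fun _ _ => .of_discrete), ENNReal.toReal_prod]
  refine Finset.prod_congr rfl fun e he => ?_
  have h1 : (e ∈ (Sym2.diagSetᶜ : Set (Sym2 (Fin n)))) = True := by simp [hA e he]
  rw [h1]
  simp only [Measure.coe_add, Pi.add_apply, Measure.coe_nnreal_smul_apply, Measure.dirac_apply,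
    bernoulliMass, Set.indicator, Pi.one_apply]
  split_ifs <;> simp [ENNReal.toReal_add]

/-- The two key rings have a common key. -/
def Meets {r P : ℕ} (b c : Fin r × Finset (Fin P)) : Prop := (b.2 ∩ c.2).Nonempty

open Classical in
/-- The probability that a channel edge of probability `p` between two nodes, whose key rings meet
iff `m` holds, leads to the adjacency status `t`. -/
def edgeFactor (p : ℝ) (m t : Prop) : ℝ :=
  if t then (if m then p else 0) else (if m then 1 - p else 1)

lemma bernoulliMass_iff (p : ℝ) (m t : Prop) :
    bernoulliMass p {q | (m ∧ q) ↔ t} = edgeFactor p m t := by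
  by_cases m <;> by_cases t <;> simp_all [bernoulliMass, edgeFactor]

lemma measureReal_prod_eq_integral {Ω Ω' : Type*} [MeasurableSpace Ω] [MeasurableSpace Ω']
    (μ : Measure Ω) (ν : Measure Ω') [IsProbabilityMeasure μ] [IsProbabilityMeasure ν]
    {E : Set (Ω × Ω')} (hE : MeasurableSet E) :
    (μ.prod ν).real E = ∫ s, ν.real (Prod.mk s ⁻¹' E) ∂μ := by
  rw [measureReal_def, Measure.prod_apply hE, integral_eq_lintegral_of_nonneg_ae]
  · congr 1
    refine lintegral_congr fun s => ?_
    rw [measureReal_def, ENNReal.ofReal_toReal (measure_ne_top _ _)]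
  · exact Eventually.of_forall fun _ => measureReal_nonneg
  · exact ((measurable_measure_prodMk_left hE).ennreal_toReal).aestronglyMeasurable

/-- The nodes in `R` have the data `a`, and each of the other nodes `z` is adjacent to exactly those
nodes `x` in `R` for which `z ∈ T x`. -/
def rootEvent {n r P : ℕ} (R : Finset (Fin n)) (a : Fin n → Fin r × Finset (Fin P))
    (T : Fin n → Finset (Fin n)) : Set ((Fin n → Fin r × Finset (Fin P)) × SimpleGraph (Fin n)) :=
  {ω | (∀ x ∈ R, ω.1 x = a x) ∧ ∀ z ∉ R, ∀ x ∈ R, ((interGraph ω).Adj z x ↔ z ∈ T x)}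

-- With the key data frozen, the event restricts only the pairs between `R` and its complement, and
-- these are independent. The indicators for `z ∈ R` are absorbed into the product so that it runs
-- over all nodes and can be integrated factor by factor.
open Classical in
lemma binomialRandom_real_rootEvent {n r P : ℕ} (α : unitInterval) (R : Finset (Fin n))
    (a s : Fin n → Fin r × Finset (Fin P)) (T : Fin n → Finset (Fin n)) :
    (SimpleGraph.binomialRandom (Fin n) α).real (Prod.mk s ⁻¹' rootEvent R a T) =
      ∏ z, if z ∈ R then (if s z = a z then 1 else 0)
        else ∏ x ∈ R, edgeFactor α (Meets (s z) (a x)) (z ∈ T x) := by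
  by_cases hs : ∀ x ∈ R, s x = a x
  -- An unordered pair does not record which end is the root, so the box at `e` quantifies over all
  -- representations; only one has its second end in `R` and its first outside.
  · have hbox : Prod.mk s ⁻¹' rootEvent R a T =
        {G | ∀ e ∈ (Rᶜ ×ˢ R).image (fun v : Fin n × Fin n => s(v.1, v.2)), (e ∈ G.edgeSet) ∈
          {q : Prop | ∀ z ∉ R, ∀ x ∈ R, e = s(z, x) → ((Meets (s z) (a x) ∧ q) ↔ z ∈ T x)}} := by
      ext G
      simp only [rootEvent, Set.mem_preimage, Set.mem_ofPred_eq, Finset.mem_image,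
        Finset.mem_product, Finset.mem_compl, Prod.exists, forall_exists_index, and_imp]
      constructor
      · rintro ⟨-, h⟩ e z' x' hz' hx' rfl z hz x hx he
        rw [← h z hz x hx, he, SimpleGraph.mem_edgeSet]
        have : z ≠ x := by rintro rfl; exact hz hx
        simp [interGraph, keyGraph, this, Meets, hs x hx]
      · intro h
        refine ⟨hs, fun z hz x hx => ?_⟩
        rw [← h _ z x hz hx rfl z hz x hx rfl]
        have : z ≠ x := by rintro rfl; exact hz hx
        simp [interGraph, keyGraph, this, Meets, hs x hx]
    have hinj : Set.InjOn (fun v : Fin n × Fin n => s(v.1, v.2)) (Rᶜ ×ˢ R : Finset _) := by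
      rintro ⟨z, x⟩ h ⟨z', x'⟩ h' he
      simp only [Finset.coe_product, Set.mem_prod, Finset.mem_coe, Finset.mem_compl] at h h'
      simp only [Sym2.eq_iff] at he
      rcases he with ⟨rfl, rfl⟩ | ⟨rfl, rfl⟩
      · rfl
      · exact absurd h'.2 h.1
    rw [hbox, binomialRandom_real_box, Finset.prod_image hinj, Finset.prod_product,
      ← Finset.prod_compl_mul_prod R]
    · have h2 : (∏ z ∈ R, if z ∈ R then (if s z = a z then (1 : ℝ) else 0)
          else ∏ x ∈ R, edgeFactor α (Meets (s z) (a x)) (z ∈ T x)) = 1 :=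
        Finset.prod_eq_one fun z hz => by simp [hz, hs z hz]
      rw [h2, mul_one]
      refine Finset.prod_congr rfl fun z hz => ?_
      rw [Finset.mem_compl] at hz
      rw [if_neg hz]
      refine Finset.prod_congr rfl fun x hx => ?_
      rw [← bernoulliMass_iff]
      congr 1
      ext q
      simp only [Set.mem_ofPred_eq]
      constructor
      · intro h
        exact h z hz x hx rfl
      · intro h z' hz' x' hx' he
        simp only [Sym2.eq_iff] at he
        rcases he with ⟨rfl, rfl⟩ | ⟨rfl, rfl⟩
        · exact h
        · exact absurd hx hz'
    · intro e he
      simp only [Finset.mem_image, Finset.mem_product, Finset.mem_compl, Prod.exists] at he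
      obtain ⟨z, x, ⟨hz, hx⟩, rfl⟩ := he
      simp only [Sym2.mk_isDiag_iff]
      rintro rfl
      exact hz hx
  · push Not at hs
    obtain ⟨x, hx, hne⟩ := hs
    have : Prod.mk s ⁻¹' rootEvent R a T = ∅ := by
      ext G
      simp only [rootEvent, Set.mem_preimage, Set.mem_ofPred_eq, Set.mem_empty_iff_false,
        iff_false]
      exact fun h => hne (h.1 x hx)
    rw [this, measureReal_empty, eq_comm]
    exact Finset.prod_eq_zero (Finset.mem_univ x) (by simp [hx, hne])

open Classical in
lemma modelMeasure_real_rootEvent {n r P : ℕ} (μ : Fin r → ℝ) (K : Fin r → ℕ) (α : unitInterval)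
    [IsProbabilityMeasure (nodeLaw μ K P)] (R : Finset (Fin n))
    (a : Fin n → Fin r × Finset (Fin P)) (T : Fin n → Finset (Fin n)) :
    (modelMeasure n μ K P α).real (rootEvent R a T) =
      (∏ x ∈ R, (nodeLaw μ K P).real {a x}) *
        ∏ z ∈ Rᶜ, ∫ b, ∏ x ∈ R, edgeFactor α (Meets b (a x)) (z ∈ T x) ∂nodeLaw μ K P := by
  rw [modelMeasure, measureReal_prod_eq_integral _ _ .of_discrete]
  simp_rw [binomialRandom_real_rootEvent]
  rw [integral_fintype_prod_eq_prod (𝕜 := ℝ) (f := fun z b => if z ∈ R then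
    (if b = a z then 1 else 0) else ∏ x ∈ R, edgeFactor α (Meets b (a x)) (z ∈ T x)),
    ← Finset.prod_mul_prod_compl R]
  congr 1
  · refine Finset.prod_congr rfl fun x hx => ?_
    simp only [hx, if_true]
    rw [← integral_indicator_one (.of_discrete)]
    congr 1
    ext b
    simp [Set.indicator]
  · refine Finset.prod_congr rfl fun z hz => ?_
    rw [Finset.mem_compl] at hz
    simp only [hz, if_false]

/-! ### Intersection probabilities of uniform key rings. -/

open Classical in
/-- The probability that a uniform `k`-element subset of `Fin P` has the property `p`. -/
def ringProb (P k : ℕ) (p : Finset (Fin P) → Prop) : ℝ :=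
  (((Finset.univ.powersetCard k).filter p).card : ℝ) / (P.choose k : ℝ)

lemma ringProb_nonneg {P k : ℕ} (p : Finset (Fin P) → Prop) : 0 ≤ ringProb P k p := by
  unfold ringProb; positivity

lemma ringProb_mono {P k : ℕ} {p q : Finset (Fin P) → Prop}
    (h : ∀ S, S.card = k → p S → q S) : ringProb P k p ≤ ringProb P k q := by
  unfold ringProb
  gcongr ?_ / _
  exact_mod_cast Finset.card_le_card fun S hS => by
    simp only [Finset.mem_filter, Finset.mem_powersetCard, Finset.subset_univ, true_and] at hS ⊢
    exact ⟨hS.1, h S hS.1 hS.2⟩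

lemma ringProb_or_add_and {P k : ℕ} (p q : Finset (Fin P) → Prop) :
    ringProb P k (fun S => p S ∨ q S) + ringProb P k (fun S => p S ∧ q S) =
      ringProb P k p + ringProb P k q := by
  classical
  unfold ringProb
  rw [← add_div, ← add_div]
  congr 1
  have := Finset.card_union_add_card_inter
    ((Finset.univ.powersetCard k).filter p) ((Finset.univ.powersetCard k).filter q)
  rw [← Finset.filter_or, ← Finset.filter_and] at this
  norm_cast
  convert this

lemma ringProb_or_le {P k : ℕ} (p q : Finset (Fin P) → Prop) :
    ringProb P k (fun S => p S ∨ q S) ≤ ringProb P k p + ringProb P k q := by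
  have := ringProb_or_add_and (P := P) (k := k) p q
  linarith [ringProb_nonneg (k := k) (fun S => p S ∧ q S)]

lemma ringProb_exists_le {P k : ℕ} {ι : Type*} (s : Finset ι) (p : ι → Finset (Fin P) → Prop) :
    ringProb P k (fun S => ∃ i ∈ s, p i S) ≤ ∑ i ∈ s, ringProb P k (p i) := by
  classical
  induction s using Finset.induction_on with
  | empty => simp [ringProb]
  | insert i s hi ih =>
    rw [Finset.sum_insert hi]
    calc _ ≤ ringProb P k (fun S => p i S ∨ ∃ j ∈ s, p j S) :=
          ringProb_mono fun S _ h => by simpa using h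
      _ ≤ _ := (ringProb_or_le _ _).trans (by gcongr)

lemma ringProb_true {P k : ℕ} (h : k ≤ P) : ringProb P k (fun _ => True) = 1 := by
  have : (P.choose k : ℝ) ≠ 0 := by exact_mod_cast (Nat.choose_pos h).ne'
  simp [ringProb, this]

lemma ringProb_hit {P k : ℕ} (h : k ≤ P) (A : Finset (Fin P)) :
    ringProb P k (fun S => (S ∩ A).Nonempty) = shareProb P A.card k := by
  classical
  have h0 : (P.choose k : ℝ) ≠ 0 := by exact_mod_cast (Nat.choose_pos h).ne'
  have h1 : ((Finset.univ.powersetCard k).filter fun S : Finset (Fin P) => ¬ (S ∩ A).Nonempty) =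
      Aᶜ.powersetCard k := by
    ext S
    simp only [Finset.mem_filter, Finset.mem_powersetCard, Finset.subset_univ, true_and,
      Finset.not_nonempty_iff_eq_empty, ← Finset.disjoint_iff_inter_eq_empty,
      Finset.subset_compl_iff_disjoint_right]
    exact and_comm
  have h2 := Finset.card_filter_add_card_filter_not (s := Finset.univ.powersetCard k)
    (fun S : Finset (Fin P) => (S ∩ A).Nonempty)
  rw [h1, Finset.card_powersetCard, Finset.card_powersetCard, Finset.card_compl, Finset.card_univ,
    Fintype.card_fin] at h2
  unfold ringProb shareProb
  rw [eq_sub_iff_add_eq, ← add_div, div_eq_one_iff_eq h0]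
  norm_cast
  convert h2

lemma ringProb_hit_and {P k : ℕ} (h : k ≤ P) (A B : Finset (Fin P)) :
    ringProb P k (fun S => (S ∩ A).Nonempty ∧ (S ∩ B).Nonempty) =
      shareProb P A.card k + shareProb P B.card k - shareProb P (A ∪ B).card k := by
  classical
  have := ringProb_or_add_and (P := P) (k := k) (fun S => (S ∩ A).Nonempty)
    (fun S => (S ∩ B).Nonempty)
  rw [ringProb_hit h, ringProb_hit h] at this
  rw [← this, ← ringProb_hit h (A ∪ B)]
  simp [Finset.inter_union_distrib_left, Finset.union_nonempty]

lemma shareProb_nonneg {P a k : ℕ} : 0 ≤ shareProb P a k := by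
  unfold shareProb
  rw [sub_nonneg]
  apply div_le_one_of_le₀ _ (by positivity)
  exact_mod_cast Nat.choose_le_choose k (Nat.sub_le P a)

lemma shareProb_mono {P a b k : ℕ} (h : a ≤ b) : shareProb P a k ≤ shareProb P b k := by
  unfold shareProb
  gcongr

/-- Passing from k to k + 1 multiplies the two sides by (P-a-b-k)(P-k) and (P-a-k)(P-b-k), up to a
common factor; the second product exceeds the first by ab. -/
lemma choose_mul_choose_le (P a b k : ℕ) :
    (P - (a + b)).choose k * P.choose k ≤ (P - a).choose k * (P - b).choose k := by
  induction k with
  | zero => simp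
  | succ k ih =>
    have e (m : ℕ) : m.choose (k + 1) * (k + 1) = m.choose k * (m - k) :=
      Nat.choose_succ_right_eq m k
    have h : (P - (a + b) - k) * (P - k) ≤ (P - a - k) * (P - b - k) := by
      rcases le_or_gt (P - (a + b)) k with h | h
      · simp [Nat.sub_eq_zero_of_le h]
      · obtain ⟨d, rfl⟩ : ∃ d, P = a + b + k + d := ⟨P - (a + b + k), by omega⟩
        have h1 : a + b + k + d - (a + b) - k = d := by omega
        have h2 : a + b + k + d - k = a + b + d := by omega
        have h3 : a + b + k + d - a - k = b + d := by omega
        have h4 : a + b + k + d - b - k = a + d := by omega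
        rw [h1, h2, h3, h4]
        nlinarith [Nat.zero_le (a * b)]
    have := Nat.mul_le_mul ih h
    have hk : 0 < (k + 1) * (k + 1) := by positivity
    refine Nat.le_of_mul_le_mul_right ?_ hk
    calc _ = ((P - (a + b)).choose (k + 1) * (k + 1)) * (P.choose (k + 1) * (k + 1)) := by ring
      _ = ((P - (a + b)).choose k * P.choose k) * ((P - (a + b) - k) * (P - k)) := by
          rw [e, e]; ring
      _ ≤ _ := this
      _ = ((P - a).choose k * (P - a - k)) * ((P - b).choose k * (P - b - k)) := by ring
      _ = _ := by rw [← e, ← e]; ring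

/-- Missing two disjoint sets of keys is negatively correlated. -/
lemma one_sub_shareProb_add_le {P a b k : ℕ} (h : k ≤ P) :
    1 - shareProb P (a + b) k ≤ (1 - shareProb P a k) * (1 - shareProb P b k) := by
  have h0 : (0 : ℝ) < P.choose k := by exact_mod_cast Nat.choose_pos h
  simp only [shareProb, sub_sub_cancel]
  rw [div_mul_div_comm, div_le_div_iff₀ h0 (by positivity)]
  have := choose_mul_choose_le P a b k
  have h2 : ((P - (a + b)).choose k * P.choose k : ℝ) ≤ (P - a).choose k * (P - b).choose k := by
    exact_mod_cast this
  nlinarith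

lemma shareProb_one {P k : ℕ} (hP : 0 < P) (h : k ≤ P) : shareProb P 1 k = k / P := by
  obtain ⟨m, rfl⟩ : ∃ m, P = m + 1 := ⟨P - 1, by omega⟩
  have h0 : ((m + 1).choose k : ℝ) ≠ 0 := by exact_mod_cast (Nat.choose_pos h).ne'
  have h1 : m.choose k * (m + 1) = (m + 1).choose k * (m + 1 - k) := Nat.choose_mul_succ_eq m k
  have h2 : (m.choose k : ℝ) * (m + 1) = (m + 1).choose k * (m + 1 - k) := by
    have := congrArg (Nat.cast : ℕ → ℝ) h1
    push_cast [Nat.cast_sub h] at this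
    exact this
  have h3 : ((m : ℝ) + 1) ≠ 0 := by positivity
  simp only [shareProb, Nat.add_sub_cancel]
  push_cast
  field_simp
  linarith

/-- Hitting a set of a + 1 keys means hitting a chosen key or the other a keys, and the first is no
more likely than the second. Removing a key therefore costs at most half of the probability. -/
lemma shareProb_succ_le {P a k : ℕ} (ha : 1 ≤ a) (haP : a + 1 ≤ P) (h : k ≤ P) :
    shareProb P (a + 1) k ≤ 2 * shareProb P a k := by
  classical
  obtain ⟨A, -, hA⟩ := Finset.exists_subset_card_eq (s := (Finset.univ : Finset (Fin P)))
    (n := a + 1) (by simpa using haP)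
  obtain ⟨w, hw⟩ : A.Nonempty := Finset.card_pos.mp (by omega)
  have h1 := ringProb_or_le (P := P) (k := k) (fun S => (S ∩ (A.erase w)).Nonempty)
    (fun S => (S ∩ {w}).Nonempty)
  rw [ringProb_hit h, ringProb_hit h, Finset.card_erase_of_mem hw, hA] at h1
  have h2 : ringProb P k (fun S => (S ∩ A).Nonempty) ≤ _ := le_trans (ringProb_mono (by
    rintro S - ⟨v, hv⟩
    rw [Finset.mem_inter] at hv
    by_cases hvw : v = w
    · exact Or.inr ⟨v, by simp [hvw]; exact hvw ▸ hv.1⟩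
    · exact Or.inl ⟨v, by simp [hv.1, hv.2, hvw]⟩)) h1
  rw [ringProb_hit h, hA] at h2
  have h3 : shareProb P 1 k ≤ shareProb P a k := shareProb_mono ha
  simp at h2
  linarith

lemma ringProb_hit_and_of_disjoint {P k : ℕ} (h : k ≤ P) {A B : Finset (Fin P)}
    (hAB : Disjoint A B) :
    ringProb P k (fun S => (S ∩ A).Nonempty ∧ (S ∩ B).Nonempty) ≤
      shareProb P A.card k * shareProb P B.card k := by
  rw [ringProb_hit_and h, Finset.card_union_of_disjoint hAB]
  have := one_sub_shareProb_add_le (P := P) (a := A.card) (b := B.card) h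
  nlinarith

/-- Write s_a for the hitting probability of a keys. The union has a + (a-1) keys, so
inclusion-exclusion and the negative correlation of misses give s_a - s_{a-1} + s_a s_{a-1}. Since a
- 1 ≥ 1, s_{a-1} is at least s_a / 2; this is the source of the decisive factor 1/2. -/
lemma ringProb_hit_and_of_card_inter {P k a : ℕ} (h : k ≤ P) (ha : 2 ≤ a) {A B : Finset (Fin P)}
    (hA : A.card = a) (hB : B.card = a) (hAB : (A ∩ B).card = 1) :
    ringProb P k (fun S => (S ∩ A).Nonempty ∧ (S ∩ B).Nonempty) ≤
      shareProb P a k / 2 + shareProb P a k ^ 2 := by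
  rw [ringProb_hit_and h, hA, hB]
  obtain ⟨c, rfl⟩ : ∃ c, a = c + 1 := ⟨a - 1, by omega⟩
  have hc : (A ∪ B).card = (c + 1) + c := by
    have := Finset.card_union_add_card_inter A B
    omega
  have haP : c + 1 ≤ P := by simpa [hA] using Finset.card_le_univ A
  have h1 := one_sub_shareProb_add_le (P := P) (a := c + 1) (b := c) h
  have h2 := shareProb_succ_le (P := P) (a := c) (by omega) haP h
  have h3 : shareProb P c k ≤ shareProb P (c + 1) k := shareProb_mono (by omega)
  rw [hc]
  nlinarith [shareProb_nonneg (P := P) (a := c + 1) (k := k)]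

/-- The mean number of common keys is controlled by the probability of having one. -/
lemma sq_div_le_two_mul_shareProb {P a : ℕ} (hP : 0 < P) (haP : a ≤ P)
    (hs : shareProb P a a ≤ 1 / 2) : (a : ℝ) ^ 2 / P ≤ 2 * shareProb P a a := by
  set x : ℝ := a / P with hx
  have hx0 : 0 ≤ x := by positivity
  have hx1 : x ≤ 1 := div_le_one_of_le₀ (by exact_mod_cast haP) (by positivity)
  have hpow (b : ℕ) : 1 - shareProb P b a ≤ (1 - x) ^ b := by
    induction b with
    | zero =>
      have : 0 ≤ shareProb P 0 a := shareProb_nonneg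
      simpa using this
    | succ b ih =>
      have h1 := one_sub_shareProb_add_le (P := P) (a := b) (b := 1) haP
      rw [shareProb_one hP haP, ← hx] at h1
      rw [pow_succ]
      exact h1.trans (mul_le_mul_of_nonneg_right ih (by linarith))
  have h1 := hpow a
  -- Bernoulli's inequality. Combined with `h1` it yields (1-s)(1+ax) ≤ 1, so ax ≤ s/(1-s) ≤ 2s,
  -- where s is `shareProb P a a`.
  have h2 : (1 - x) ^ a * (1 + a * x) ≤ 1 := by
    calc (1 - x) ^ a * (1 + a * x) ≤ (1 - x) ^ a * (1 + x) ^ a :=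
          mul_le_mul_of_nonneg_left (one_add_mul_le_pow (by linarith) a)
            (pow_nonneg (by linarith) _)
      _ = (1 - x ^ 2) ^ a := by rw [← mul_pow]; ring_nf
      _ ≤ 1 := pow_le_one₀ (by nlinarith) (by nlinarith)
  have h3 : (a : ℝ) ^ 2 / P = a * x := by rw [hx]; ring
  rw [h3]
  have h4 : 0 ≤ a * x := by positivity
  have h5 : (1 - shareProb P a a) * (1 + a * x) ≤ 1 :=
    (mul_le_mul_of_nonneg_right h1 (by linarith)).trans h2
  nlinarith

/-- A union bound over a common key w: hitting w and hitting the rest of `A` are negatively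
correlated, so the total is at most a · (a/P) · s, and a²/P ≤ 2s. -/
lemma ringProb_two_le_card_inter {P a : ℕ} (haP : a ≤ P) (hs : shareProb P a a ≤ 1 / 2)
    {A : Finset (Fin P)} (hA : A.card = a) :
    ringProb P a (fun S => 2 ≤ (A ∩ S).card) ≤ 2 * shareProb P a a ^ 2 := by
  classical
  rcases Nat.eq_zero_or_pos P with rfl | hP
  · have : ringProb 0 a (fun S => 2 ≤ (A ∩ S).card) = 0 := by
      simp [ringProb, Finset.eq_empty_of_isEmpty A]
    rw [this]; positivity
  have hstep (w : Fin P) (hw : w ∈ A) :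
      ringProb P a (fun S => (S ∩ {w}).Nonempty ∧ (S ∩ A.erase w).Nonempty) ≤
        a / P * shareProb P a a := by
    refine (ringProb_hit_and_of_disjoint haP (by simp)).trans ?_
    rw [Finset.card_singleton, shareProb_one hP haP, Finset.card_erase_of_mem hw, hA]
    gcongr
    exact shareProb_mono (by omega)
  calc ringProb P a (fun S => 2 ≤ (A ∩ S).card)
      ≤ ringProb P a (fun S => ∃ w ∈ A, (S ∩ {w}).Nonempty ∧ (S ∩ A.erase w).Nonempty) := by
        refine ringProb_mono fun S _ h => ?_
        obtain ⟨v, hv, w, hw, hvw⟩ := Finset.one_lt_card.mp h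
        rw [Finset.mem_inter] at hv hw
        exact ⟨v, hv.1, ⟨v, by simp [hv.2]⟩, ⟨w, by simp [hw.1, hw.2, hvw.symm]⟩⟩
    _ ≤ ∑ w ∈ A, a / P * shareProb P a a :=
        (ringProb_exists_le _ _).trans (Finset.sum_le_sum hstep)
    _ = (a : ℝ) ^ 2 / P * shareProb P a a := by
        rw [Finset.sum_const, hA, nsmul_eq_mul]; ring
    _ ≤ 2 * shareProb P a a * shareProb P a a := by
        gcongr
        · exact shareProb_nonneg
        · exact sq_div_le_two_mul_shareProb hP haP hs
    _ = _ := by ring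

/-! ### The law of one node and its adjacency to one or two roots. -/

section NodeLaw

variable {r P : ℕ} {μ : Fin r → ℝ} {K : Fin r → ℕ}

lemma uniformOn_card_real {k : ℕ} (p : Finset (Fin P) → Prop) :
    (uniformOn {S : Finset (Fin P) | S.card = k}).real {S | p S} = ringProb P k p := by
  classical
  have h1 : {S : Finset (Fin P) | S.card = k} =
      ((Finset.univ.powersetCard k : Finset (Finset (Fin P))) : Set (Finset (Fin P))) := by
    ext S; simp
  have h2 : {S : Finset (Fin P) | p S} =
      ((Finset.univ.filter p : Finset (Finset (Fin P))) : Set (Finset (Fin P))) := by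
    ext S; simp
  rw [measureReal_def, h1, h2, uniformOn_apply_finset, Finset.card_powersetCard, ringProb,
    Finset.card_univ, Fintype.card_fin, ENNReal.toReal_div]
  congr 2
  norm_cast
  congr 1
  ext S
  simp

lemma nodeLaw_real (hμ : ∀ i, 0 ≤ μ i) (hK : ∀ i, K i ≤ P) (E : Set (Fin r × Finset (Fin P))) :
    (nodeLaw μ K P).real E = ∑ j, μ j * ringProb P (K j) (fun S => (j, S) ∈ E) := by
  have hfin (j : Fin r) :
      IsProbabilityMeasure (uniformOn {S : Finset (Fin P) | S.card = K j}) := by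
    apply isProbabilityMeasure_uniformOn (Set.toFinite _)
    obtain ⟨A, -, hA⟩ := Finset.exists_subset_card_eq (s := (Finset.univ : Finset (Fin P)))
      (n := K j) (by simpa using hK j)
    exact ⟨A, hA⟩
  rw [measureReal_def, nodeLaw, Measure.finsetSum_apply, ENNReal.toReal_sum]
  · refine Finset.sum_congr rfl fun j _ => ?_
    rw [Measure.smul_apply, smul_eq_mul, ENNReal.toReal_mul, ENNReal.toReal_ofReal (hμ j),
      Measure.dirac_prod, Measure.map_apply (by fun_prop) .of_discrete, ← measureReal_def,
      ← uniformOn_card_real]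
    rfl
  · intro j _
    rw [Measure.smul_apply, smul_eq_mul]
    exact ENNReal.mul_ne_top ENNReal.ofReal_ne_top (measure_ne_top _ _)

lemma isProbabilityMeasure_nodeLaw (hμ : ∀ i, 0 ≤ μ i) (hμ_sum : ∑ i, μ i = 1)
    (hK : ∀ i, K i ≤ P) : IsProbabilityMeasure (nodeLaw μ K P) := by
  refine ⟨?_⟩
  have h := nodeLaw_real hμ hK Set.univ
  simp only [Set.mem_univ, ringProb_true (hK _), mul_one, hμ_sum] at h
  rw [measureReal_def] at h
  exact (ENNReal.toReal_eq_one_iff _).mp h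

/-- The probability that the key ring of a random node meets a set of `a` keys. -/
def meanShareProb (μ : Fin r → ℝ) (K : Fin r → ℕ) (P a : ℕ) : ℝ :=
  ∑ j, shareProb P a (K j) * μ j

/-- The probability that the key ring of a random node meets both `A` and `B`. -/
def meetBothProb (μ : Fin r → ℝ) (K : Fin r → ℕ) (P : ℕ) (A B : Finset (Fin P)) : ℝ :=
  ∑ j, μ j * ringProb P (K j) (fun S => (S ∩ A).Nonempty ∧ (S ∩ B).Nonempty)

lemma nodeLaw_real_meets (hμ : ∀ i, 0 ≤ μ i) (hK : ∀ i, K i ≤ P) (a : Fin r × Finset (Fin P)) :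
    (nodeLaw μ K P).real {b | Meets b a} = meanShareProb μ K P a.2.card := by
  rw [nodeLaw_real hμ hK, meanShareProb]
  refine Finset.sum_congr rfl fun j _ => ?_
  rw [← ringProb_hit (hK j), mul_comm]
  rfl

lemma nodeLaw_real_meets_both (hμ : ∀ i, 0 ≤ μ i) (hK : ∀ i, K i ≤ P)
    (a a' : Fin r × Finset (Fin P)) :
    (nodeLaw μ K P).real {b | Meets b a ∧ Meets b a'} = meetBothProb μ K P a.2 a'.2 :=
  nodeLaw_real hμ hK _

/-- Data with a ring of the wrong size form a null set; in sums over all data the ring size may be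
read off from the class. -/
lemma card_eq_of_nodeLaw_real_ne_zero (hμ : ∀ i, 0 ≤ μ i) (hK : ∀ i, K i ≤ P)
    {a : Fin r × Finset (Fin P)} (ha : (nodeLaw μ K P).real {a} ≠ 0) : a.2.card = K a.1 := by
  by_contra h
  apply ha
  rw [nodeLaw_real hμ hK]
  refine Finset.sum_eq_zero fun j _ => ?_
  have : ringProb P (K j) (fun S => (j, S) ∈ ({a} : Set _)) = 0 := by
    refine le_antisymm ((ringProb_mono (q := fun _ => False) ?_).trans (by simp [ringProb]))
      (ringProb_nonneg _)
    rintro S hS rfl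
    exact h hS
  rw [this, mul_zero]

variable (p : ℝ) (a a' : Fin r × Finset (Fin P)) (t t' : Prop)

lemma integral_edgeFactor [Decidable t] (hμ : ∀ i, 0 ≤ μ i) (hμ_sum : ∑ i, μ i = 1) (hK : ∀ i, K i ≤ P) :
    ∫ b, edgeFactor p (Meets b a) t ∂nodeLaw μ K P =
      if t then p * meanShareProb μ K P a.2.card else 1 - p * meanShareProb μ K P a.2.card := by
  have := isProbabilityMeasure_nodeLaw hμ hμ_sum hK
  have hi : ∫ b, Set.indicator {b | Meets b a} 1 b ∂nodeLaw μ K P =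
      meanShareProb μ K P a.2.card := by
    rw [integral_indicator_one .of_discrete, nodeLaw_real_meets hμ hK]
  rw [← hi, ← integral_const_mul]
  split_ifs with h
  · congr 1
    ext b
    by_cases hb : Meets b a <;> simp [edgeFactor, h, hb]
  · rw [← probReal_univ (μ := nodeLaw μ K P), ← integral_indicator_one .univ,
      ← integral_sub .of_finite .of_finite]
    congr 1
    ext b
    by_cases hb : Meets b a <;> simp [edgeFactor, h, hb]

/-- Given the ring of the third node, its two channels are independent, so adjacency to both roots
carries p²; the other three cases follow by complement. -/
lemma integral_edgeFactor_mul [Decidable t] [Decidable t'] (hμ : ∀ i, 0 ≤ μ i) (hμ_sum : ∑ i, μ i = 1) (hK : ∀ i, K i ≤ P) :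
    ∫ b, edgeFactor p (Meets b a) t * edgeFactor p (Meets b a') t' ∂nodeLaw μ K P =
      if t then
        if t' then p ^ 2 * meetBothProb μ K P a.2 a'.2
        else p * meanShareProb μ K P a.2.card - p ^ 2 * meetBothProb μ K P a.2 a'.2
      else
        if t' then p * meanShareProb μ K P a'.2.card - p ^ 2 * meetBothProb μ K P a.2 a'.2
        else 1 - p * meanShareProb μ K P a.2.card - p * meanShareProb μ K P a'.2.card
          + p ^ 2 * meetBothProb μ K P a.2 a'.2 := by
  have := isProbabilityMeasure_nodeLaw hμ hμ_sum hK
  have hi (a : Fin r × Finset (Fin P)) : p * meanShareProb μ K P a.2.card =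
      ∫ b, p * Set.indicator {b | Meets b a} 1 b ∂nodeLaw μ K P := by
    rw [integral_const_mul, integral_indicator_one .of_discrete, nodeLaw_real_meets hμ hK]
  have hi2 : p ^ 2 * meetBothProb μ K P a.2 a'.2 =
      ∫ b, p ^ 2 * Set.indicator {b | Meets b a ∧ Meets b a'} 1 b ∂nodeLaw μ K P := by
    rw [integral_const_mul, integral_indicator_one .of_discrete, nodeLaw_real_meets_both hμ hK]
  have h1 : (1 : ℝ) = ∫ b, Set.indicator (Set.univ) 1 b ∂nodeLaw μ K P := by
    rw [integral_indicator_one .univ, probReal_univ]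
  rw [hi, hi, hi2]
  split_ifs with h h' h'
  · congr 1
    ext b
    by_cases hb : Meets b a <;> by_cases hb' : Meets b a' <;>
      simp [edgeFactor, h, h', hb, hb']
    ring
  · rw [← integral_sub .of_finite .of_finite]
    congr 1
    ext b
    by_cases hb : Meets b a <;> by_cases hb' : Meets b a' <;>
      simp [edgeFactor, h, h', hb, hb']
    ring
  · rw [← integral_sub .of_finite .of_finite]
    congr 1
    ext b
    by_cases hb : Meets b a <;> by_cases hb' : Meets b a' <;>
      simp [edgeFactor, h, h', hb, hb']
    ring
  · rw [h1, ← integral_sub .of_finite .of_finite, ← integral_sub .of_finite .of_finite,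
      ← integral_add .of_finite .of_finite]
    congr 1
    ext b
    by_cases hb : Meets b a <;> by_cases hb' : Meets b a' <;>
      simp [edgeFactor, h, h', hb, hb']
    ring

end NodeLaw

/-! ### Binomial sums and sums over pairs of small sets. -/

/-- The probability that a binomial variable with parameters `N`, `q` is less than `k`. -/
def binomialLT (N k : ℕ) (q : ℝ) : ℝ :=
  ∑ l ∈ Finset.range k, (N.choose l : ℝ) * (q ^ l * (1 - q) ^ (N - l))

/-- The beginning of the binomial expansion of `(1 + x) ^ N`. -/
def truncBinomial (N k : ℕ) (x : ℝ) : ℝ :=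
  ∑ l ∈ Finset.range k, (N.choose l : ℝ) * x ^ l

lemma sum_powerset_card_lt {ι : Type*} (s : Finset ι) (k : ℕ) (f : ℕ → ℝ) :
    ∑ T ∈ s.powerset with T.card < k, f T.card =
      ∑ l ∈ Finset.range k, (s.card.choose l : ℝ) * f l := by
  rw [← Finset.sum_fiberwise_of_maps_to (s := s.powerset.filter fun T => T.card < k)
    (t := Finset.range k) (g := Finset.card) (by simp)]
  refine Finset.sum_congr rfl fun l hl => ?_
  have : ((s.powerset.filter fun T => T.card < k).filter fun T => T.card = l) =
      s.powersetCard l := by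
    ext T
    simp only [Finset.mem_filter, Finset.mem_powerset, Finset.mem_powersetCard,
      Finset.mem_range] at *
    constructor
    · rintro ⟨⟨h, -⟩, h'⟩
      exact ⟨h, h'⟩
    · rintro ⟨h, rfl⟩
      exact ⟨⟨h, hl⟩, rfl⟩
  rw [this, Finset.sum_congr rfl (g := fun _ => f l), Finset.sum_const, Finset.card_powersetCard,
    nsmul_eq_mul]
  intro T hT
  rw [(Finset.mem_powersetCard.mp hT).2]

lemma prod_ite_mem_eq {ι : Type*} [DecidableEq ι] {s T : Finset ι} (hT : T ⊆ s) (u v : ℝ) :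
    ∏ z ∈ s, (if z ∈ T then u else v) = u ^ T.card * v ^ (s.card - T.card) := by
  rw [Finset.prod_ite, Finset.prod_const, Finset.prod_const, Finset.filter_mem_eq_inter,
    Finset.inter_eq_right.mpr hT, ← Finset.card_sdiff_of_subset hT, Finset.sdiff_eq_filter]

/-- The sum over pairs of small subsets of the products of local weights that arise from the joint
degree distribution of two nodes. -/
lemma sum_pair_prod_le {ι : Type*} [DecidableEq ι] (s : Finset ι) (k : ℕ) {b q c : ℝ} (hb : 0 ≤ b) (hbq : b ≤ q)
    (hc : 0 < c) :
    ∑ v ∈ (s.powerset.filter fun T => T.card < k) ×ˢ (s.powerset.filter fun T => T.card < k),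
        ∏ z ∈ s, (if z ∈ v.1 then (if z ∈ v.2 then b else q - b)
          else (if z ∈ v.2 then q - b else c)) ≤
      c ^ s.card * truncBinomial s.card k (b / c) * truncBinomial s.card k (q / c) ^ 2 := by
  set 𝒯 := s.powerset.filter fun T => T.card < k with h𝒯
  -- A pair (T, T') is encoded by T ∩ T', T \ T' and T' \ T. After bounding q - b by q the weight is
  -- a product over these three sets, and forgetting that they are disjoint makes the sum factor.
  set g : Finset ι × Finset ι × Finset ι → ℝ := fun w =>
    c ^ s.card * (b / c) ^ w.1.card * ((q / c) ^ w.2.1.card * (q / c) ^ w.2.2.card) with hg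
  set φ : Finset ι × Finset ι → Finset ι × Finset ι × Finset ι :=
    fun v => (v.1 ∩ v.2, v.1 \ v.2, v.2 \ v.1) with hφ
  have hq : 0 ≤ q := hb.trans hbq
  have hpt (T : Finset ι) (hT : T ⊆ s) (u : ℝ) : u ^ T.card = ∏ z ∈ s, if z ∈ T then u else 1 := by
    rw [prod_ite_mem_eq hT, one_pow, mul_one]
  have h1 : ∀ v ∈ 𝒯 ×ˢ 𝒯, ∏ z ∈ s, (if z ∈ v.1 then (if z ∈ v.2 then b else q - b)
      else (if z ∈ v.2 then q - b else c)) ≤ g (φ v) := by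
    rintro ⟨T, T'⟩ hv
    simp only [h𝒯, Finset.mem_product, Finset.mem_filter, Finset.mem_powerset] at hv
    simp only [hg, hφ]
    rw [hpt _ (Finset.inter_subset_left.trans hv.1.1), hpt _ (Finset.sdiff_subset.trans hv.1.1),
      hpt _ (Finset.sdiff_subset.trans hv.2.1), ← Finset.prod_const, ← Finset.prod_mul_distrib,
      ← Finset.prod_mul_distrib, ← Finset.prod_mul_distrib]
    refine Finset.prod_le_prod (fun z _ => ?_) (fun z _ => ?_)
    · split_ifs <;> linarith
    · by_cases h : z ∈ T <;> by_cases h' : z ∈ T' <;> simp [h, h']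
      · rw [mul_div_cancel₀ _ hc.ne']
      · rw [mul_div_cancel₀ _ hc.ne']; linarith
      · rw [mul_div_cancel₀ _ hc.ne']; linarith
  have hinj : Set.InjOn φ (𝒯 ×ˢ 𝒯 : Finset _) := by
    rintro ⟨T, T'⟩ - ⟨U, U'⟩ - h
    simp only [hφ, Prod.mk.injEq] at h
    simp only [Finset.ext_iff, Finset.mem_inter, Finset.mem_sdiff] at h
    ext z
    · have := h.1 z; have := h.2.1 z; simp only; tauto
    · have := h.1 z; have := h.2.2 z; simp only; tauto
  calc _ ≤ ∑ v ∈ 𝒯 ×ˢ 𝒯, g (φ v) := Finset.sum_le_sum h1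
    _ = ∑ w ∈ (𝒯 ×ˢ 𝒯).image φ, g w := (Finset.sum_image hinj).symm
    _ ≤ ∑ w ∈ 𝒯 ×ˢ 𝒯 ×ˢ 𝒯, g w := by
      refine Finset.sum_le_sum_of_subset_of_nonneg ?_ fun w _ _ => by simp only [hg]; positivity
      intro w hw
      obtain ⟨⟨T, T'⟩, hv, rfl⟩ := Finset.mem_image.mp hw
      simp only [h𝒯, hφ, Finset.mem_product, Finset.mem_filter, Finset.mem_powerset] at hv ⊢
      exact ⟨⟨Finset.inter_subset_left.trans hv.1.1,
          (Finset.card_le_card Finset.inter_subset_left).trans_lt hv.1.2⟩,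
        ⟨Finset.sdiff_subset.trans hv.1.1,
          (Finset.card_le_card Finset.sdiff_subset).trans_lt hv.1.2⟩,
        ⟨Finset.sdiff_subset.trans hv.2.1,
          (Finset.card_le_card Finset.sdiff_subset).trans_lt hv.2.2⟩⟩
    _ = _ := by
      have hS (x : ℝ) : truncBinomial s.card k x = ∑ T ∈ 𝒯, x ^ T.card :=
        (sum_powerset_card_lt s k fun l => x ^ l).symm
      simp only [hg, Finset.sum_product, ← Finset.mul_sum, ← Finset.sum_mul, hS]
      ring

/-! ### Degrees of one node and of two nodes. -/

section Degree

variable {n r P : ℕ} {μ : Fin r → ℝ} {K : Fin r → ℕ}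

open Classical in
/-- The node `x` has data in `C` and degree less than `k`. -/
def lowDegreeEvent (n : ℕ) {r P : ℕ} (C : Set (Fin r × Finset (Fin P))) (k : ℕ) (x : Fin n) :
    Set ((Fin n → Fin r × Finset (Fin P)) × SimpleGraph (Fin n)) :=
  {ω | ω.1 x ∈ C ∧ (interGraph ω).degree x < k}

lemma isProbabilityMeasure_modelMeasure (hμ : ∀ i, 0 ≤ μ i) (hμ_sum : ∑ i, μ i = 1)
    (hK : ∀ i, K i ≤ P) (α : unitInterval) : IsProbabilityMeasure (modelMeasure n μ K P α) := by
  have := isProbabilityMeasure_nodeLaw hμ hμ_sum hK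
  unfold modelMeasure
  infer_instance

-- The event is partitioned by the data of `x` and its exact neighbourhood, each cell being a
-- `rootEvent` with the single root `x`.
open Classical in
lemma modelMeasure_real_lowDegreeEvent (hμ : ∀ i, 0 ≤ μ i) (hμ_sum : ∑ i, μ i = 1)
    (hK : ∀ i, K i ≤ P) (α : unitInterval) (C : Set (Fin r × Finset (Fin P))) (k : ℕ)
    (x : Fin n) :
    (modelMeasure n μ K P α).real (lowDegreeEvent n C k x) =
      ∑ a with a ∈ C, (nodeLaw μ K P).real {a} *
        binomialLT (n - 1) k (α * meanShareProb μ K P a.2.card) := by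
  have := isProbabilityMeasure_nodeLaw hμ hμ_sum hK
  have := isProbabilityMeasure_modelMeasure (n := n) hμ hμ_sum hK α
  set 𝒯 := ({x}ᶜ : Finset (Fin n)).powerset.filter fun T => T.card < k with h𝒯
  have hmem (ω : (Fin n → Fin r × Finset (Fin P)) × SimpleGraph (Fin n))
      (a : Fin r × Finset (Fin P)) (T : Finset (Fin n)) (hT : T ∈ 𝒯) :
      ω ∈ rootEvent {x} (fun _ => a) (fun _ => T) ↔
        ω.1 x = a ∧ (interGraph ω).neighborFinset x = T := by
    simp only [h𝒯, Finset.mem_filter, Finset.mem_powerset] at hT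
    simp only [rootEvent, Set.mem_ofPred_eq, Finset.mem_singleton, forall_eq]
    refine and_congr_right fun _ => ?_
    simp only [Finset.ext_iff, SimpleGraph.mem_neighborFinset, (interGraph ω).adj_comm x]
    refine forall_congr' fun z => ⟨fun h => ?_, fun h _ => h⟩
    -- At `z = x` both sides are false: the graph has no loops and `T` avoids `x`.
    by_cases hz : z = x
    · subst hz
      simpa using fun h => by simpa using hT.1 h
    · exact h hz
  have hdecomp : lowDegreeEvent n C k x = ⋃ v ∈ (Finset.univ.filter fun a => a ∈ C) ×ˢ 𝒯,
      rootEvent {x} (fun _ => v.1) (fun _ => v.2) := by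
    ext ω
    simp only [Set.mem_iUnion, exists_prop, Finset.mem_product, Finset.mem_filter,
      Finset.mem_univ, true_and, lowDegreeEvent, Set.mem_ofPred_eq]
    constructor
    · rintro ⟨hC, hd⟩
      have hT : (interGraph ω).neighborFinset x ∈ 𝒯 := by
        simp only [h𝒯, Finset.mem_filter, Finset.mem_powerset]
        refine ⟨fun z hz => ?_, by simpa using hd⟩
        rw [SimpleGraph.mem_neighborFinset] at hz
        simpa using hz.ne'
      exact ⟨(ω.1 x, (interGraph ω).neighborFinset x), ⟨hC, hT⟩, (hmem _ _ _ hT).2 ⟨rfl, rfl⟩⟩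
    · rintro ⟨⟨a, T⟩, ⟨hC, hT⟩, hω⟩
      obtain ⟨rfl, h⟩ := (hmem _ _ _ hT).1 hω
      refine ⟨hC, ?_⟩
      rw [← SimpleGraph.card_neighborFinset_eq_degree, h]
      exact (Finset.mem_filter.mp hT).2
  rw [hdecomp, measureReal_biUnion_finset, Finset.sum_product]
  · refine Finset.sum_congr rfl fun a _ => ?_
    have hcard : ({x}ᶜ : Finset (Fin n)).card = n - 1 := by
      rw [Finset.card_compl, Finset.card_singleton, Fintype.card_fin]
    rw [binomialLT, ← hcard, ← sum_powerset_card_lt ({x}ᶜ) k fun l =>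
      (α * meanShareProb μ K P a.2.card : ℝ) ^ l *
        (1 - α * meanShareProb μ K P a.2.card) ^ (({x}ᶜ : Finset (Fin n)).card - l),
      Finset.mul_sum]
    refine Finset.sum_congr rfl fun T hT => ?_
    rw [modelMeasure_real_rootEvent]
    simp only [Finset.prod_singleton, integral_edgeFactor _ _ _ hμ hμ_sum hK]
    rw [prod_ite_mem_eq (Finset.mem_powerset.mp (Finset.mem_filter.mp hT).1)]
  · rintro ⟨a, T⟩ hv ⟨a', T'⟩ hv' hne
    rw [Function.onFun, Set.disjoint_left]
    intro ω hω hω'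
    simp only [Finset.coe_product, Set.mem_prod, Finset.mem_coe] at hv hv'
    obtain ⟨h1, h2⟩ := (hmem _ _ _ hv.2).1 hω
    obtain ⟨h1', h2'⟩ := (hmem _ _ _ hv'.2).1 hω'
    exact hne (Prod.ext (h1.symm.trans h1') (h2.symm.trans h2'))
  · exact fun _ _ => .of_discrete

open Classical in
/-- The joint law of the degrees of two nodes is bounded in terms of the probability that a third
node is adjacent to both. -/
lemma modelMeasure_real_lowDegreeEvent_inter_le (hμ : ∀ i, 0 ≤ μ i) (hμ_sum : ∑ i, μ i = 1)
    (hK : ∀ i, K i ≤ P) (α : unitInterval) (i : Fin r) (k : ℕ) {x y : Fin n} (hxy : x ≠ y)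
    (hc : α * meanShareProb μ K P (K i) < 1 / 2) :
    (modelMeasure n μ K P α).real
        (lowDegreeEvent n {a | a.1 = i} k x ∩ lowDegreeEvent n {a | a.1 = i} k y) ≤
      ∑ v : (Fin r × Finset (Fin P)) × (Fin r × Finset (Fin P)) with v.1.1 = i ∧ v.2.1 = i,
        (nodeLaw μ K P).real {v.1} * (nodeLaw μ K P).real {v.2} *
        ((1 - 2 * (α * meanShareProb μ K P (K i)) +
            α ^ 2 * meetBothProb μ K P v.1.2 v.2.2) ^ (n - 2) *
          truncBinomial (n - 2) k (α ^ 2 * meetBothProb μ K P v.1.2 v.2.2 /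
            (1 - 2 * (α * meanShareProb μ K P (K i)) +
              α ^ 2 * meetBothProb μ K P v.1.2 v.2.2)) *
          truncBinomial (n - 2) k (α * meanShareProb μ K P (K i) /
            (1 - 2 * (α * meanShareProb μ K P (K i)) +
              α ^ 2 * meetBothProb μ K P v.1.2 v.2.2)) ^ 2) := by
  have := isProbabilityMeasure_nodeLaw hμ hμ_sum hK
  have := isProbabilityMeasure_modelMeasure (n := n) hμ hμ_sum hK α
  set M : Finset (Fin n) := {x, y}ᶜ with hM
  have hMcard : M.card = n - 2 := by
    rw [hM, Finset.card_compl, Finset.card_pair hxy, Fintype.card_fin]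
  set 𝒯 := M.powerset.filter fun T => T.card < k with h𝒯
  set A : ((Fin r × Finset (Fin P)) × (Fin r × Finset (Fin P))) → Fin n →
    Fin r × Finset (Fin P) := fun v z => if z = x then v.1 else v.2 with hA
  set U : (Finset (Fin n) × Finset (Fin n)) → Fin n → Finset (Fin n) :=
    fun w z => if z = x then w.1 else w.2 with hU
  -- Only neighbours other than `x` and `y` are recorded. Ignoring the possible edge between the two
  -- roots can only lower the degrees, so an inclusion results.
  have hsub : lowDegreeEvent n {a | a.1 = i} k x ∩ lowDegreeEvent n {a | a.1 = i} k y ⊆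
      ⋃ u ∈ (Finset.univ.filter fun v : (Fin r × Finset (Fin P)) × (Fin r × Finset (Fin P)) =>
        v.1.1 = i ∧ v.2.1 = i) ×ˢ (𝒯 ×ˢ 𝒯), rootEvent {x, y} (A u.1) (U u.2) := by
    rintro ω ⟨⟨hx, hdx⟩, ⟨hy, hdy⟩⟩
    simp only [Set.mem_iUnion, exists_prop, Finset.mem_product, Finset.mem_filter,
      Finset.mem_univ, true_and]
    have hT (z : Fin n) (hd : (interGraph ω).degree z < k) :
        (interGraph ω).neighborFinset z ∩ M ∈ 𝒯 := by
      simp only [h𝒯, Finset.mem_filter, Finset.mem_powerset]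
      refine ⟨Finset.inter_subset_right, lt_of_le_of_lt
        (Finset.card_le_card Finset.inter_subset_left) (by simpa using hd)⟩
    refine ⟨((ω.1 x, ω.1 y), ((interGraph ω).neighborFinset x ∩ M,
      (interGraph ω).neighborFinset y ∩ M)), ⟨⟨hx, hy⟩, hT x hdx, hT y hdy⟩, ?_⟩
    simp only [rootEvent, Set.mem_ofPred_eq, Finset.mem_insert, Finset.mem_singleton,
      forall_eq_or_imp, forall_eq, hA, hU, if_true, if_neg hxy.symm, true_and, hM,
      Finset.mem_inter, SimpleGraph.mem_neighborFinset, Finset.mem_compl]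
    intro z hz
    simp [hz, SimpleGraph.adj_comm]
  refine (measureReal_mono hsub (measure_ne_top _ _)).trans ((measureReal_biUnion_finset_le _ _).trans ?_)
  rw [Finset.sum_product]
  refine Finset.sum_le_sum fun v hv => ?_
  simp only [Finset.mem_filter, Finset.mem_univ, true_and] at hv
  have hprob (w : Finset (Fin n) × Finset (Fin n)) :
      (modelMeasure n μ K P α).real (rootEvent {x, y} (A v) (U w)) =
        (nodeLaw μ K P).real {v.1} * (nodeLaw μ K P).real {v.2} * ∏ z ∈ M,
          ∫ b, edgeFactor α (Meets b v.1) (z ∈ w.1) * edgeFactor α (Meets b v.2) (z ∈ w.2)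
            ∂nodeLaw μ K P := by
    rw [modelMeasure_real_rootEvent]
    simp only [Finset.prod_pair hxy, hA, hU, if_true, if_neg hxy.symm, hM]
  simp_rw [hprob]
  rw [← Finset.mul_sum]
  rcases eq_or_ne ((nodeLaw μ K P).real {v.1} * (nodeLaw μ K P).real {v.2}) 0 with h0 | h0
  · rw [h0, zero_mul, zero_mul]
  refine mul_le_mul_of_nonneg_left ?_ (by positivity)
  have hc1 := card_eq_of_nodeLaw_real_ne_zero hμ hK (left_ne_zero_of_mul h0)
  have hc2 := card_eq_of_nodeLaw_real_ne_zero hμ hK (right_ne_zero_of_mul h0)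
  rw [hv.1] at hc1
  rw [hv.2] at hc2
  simp only [integral_edgeFactor_mul _ _ _ _ _ hμ hμ_sum hK, hc1, hc2]
  set q := (α : ℝ) * meanShareProb μ K P (K i) with hq
  set b := (α : ℝ) ^ 2 * meetBothProb μ K P v.1.2 v.2.2 with hb
  have hα0 : (0 : ℝ) ≤ α := α.2.1
  have hb0 : 0 ≤ b := by
    refine mul_nonneg (by positivity) (Finset.sum_nonneg fun j _ => ?_)
    exact mul_nonneg (hμ j) (ringProb_nonneg _)
  have hbq : b ≤ q := by
    have h1 : meetBothProb μ K P v.1.2 v.2.2 ≤ meanShareProb μ K P (K i) := by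
      rw [← nodeLaw_real_meets_both hμ hK, ← hc1, ← nodeLaw_real_meets hμ hK]
      exact measureReal_mono fun b hb => hb.1
    have h2 : 0 ≤ meetBothProb μ K P v.1.2 v.2.2 := by
      rw [← nodeLaw_real_meets_both hμ hK]; exact measureReal_nonneg
    calc b ≤ α * meetBothProb μ K P v.1.2 v.2.2 := by
          refine mul_le_mul_of_nonneg_right ?_ h2
          nlinarith [α.2.2]
      _ ≤ q := by rw [hq]; gcongr
  have hc0 : 0 < 1 - 2 * q + b := by linarith
  have := sum_pair_prod_le M k hb0 hbq hc0
  rw [hMcard] at this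
  have e : 1 - 2 * q + b = 1 - q - q + b := by ring
  rw [e] at this ⊢
  exact this

end Degree

/-! ### The joint law of two degrees against the product of the marginals. -/

lemma geom_sum_le_one_add_pow {y : ℝ} (hy : 0 ≤ y) (k : ℕ) :
    ∑ l ∈ Finset.range (k + 1), y ^ l ≤ (1 + y) ^ k := by
  induction k with
  | zero => simp
  | succ k ih =>
    rw [geom_sum_succ, pow_succ]
    have : 1 ≤ (1 + y) ^ k := one_le_pow₀ (by linarith)
    nlinarith

lemma truncBinomial_nonneg (N k : ℕ) {x : ℝ} (hx : 0 ≤ x) : 0 ≤ truncBinomial N k x :=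
  Finset.sum_nonneg fun _ _ => by positivity

lemma truncBinomial_le (N k : ℕ) {x : ℝ} (hx : 0 ≤ x) :
    truncBinomial N k x ≤ (1 + N * x) ^ k := by
  have hy : (0 : ℝ) ≤ N * x := by positivity
  refine (Finset.sum_le_sum fun l _ => ?_).trans ((Finset.sum_le_sum_of_subset_of_nonneg
    (Finset.range_mono k.le_succ) fun l _ _ => pow_nonneg hy l).trans
    (geom_sum_le_one_add_pow hy k))
  rw [mul_pow]
  gcongr
  exact_mod_cast Nat.choose_le_pow N l

lemma truncBinomial_div_le (N k : ℕ) {x c : ℝ} (hx : 0 ≤ x) (hc : 0 < c) (hc1 : c ≤ 1) :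
    truncBinomial N k (x / c) ≤ truncBinomial N k x / c ^ k := by
  rw [truncBinomial, truncBinomial, Finset.sum_div]
  refine Finset.sum_le_sum fun l hl => ?_
  rw [div_pow, mul_div_assoc]
  have : c ^ k ≤ c ^ l := pow_le_pow_of_le_one hc.le hc1 (Finset.mem_range.mp hl).le
  gcongr

/-- This puts the marginal in the form taken by the joint bound, with the m nodes other than the two
roots in the truncated sum, so that these sums cancel in the comparison. -/
lemma le_binomialLT {m k : ℕ} {q : ℝ} (hq : 0 ≤ q) (hq1 : q ≤ 1) :
    (1 - q) ^ (m + 1) * truncBinomial m k q ≤ binomialLT (m + 1) k q := by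
  rw [truncBinomial, binomialLT, Finset.mul_sum]
  refine Finset.sum_le_sum fun l _ => ?_
  have h1 : (m.choose l : ℝ) ≤ (m + 1).choose l := by
    exact_mod_cast Nat.choose_le_choose l (Nat.le_succ m)
  have h2 : (1 - q) ^ (m + 1) ≤ (1 - q) ^ (m + 1 - l) :=
    pow_le_pow_of_le_one (by linarith) (by linarith) (Nat.sub_le _ _)
  have h3 : 0 ≤ 1 - q := by linarith
  calc _ = (m.choose l : ℝ) * (q ^ l * (1 - q) ^ (m + 1)) := by ring
    _ ≤ _ := by gcongr

/-- The factor by which the joint probability that two nodes have small degree may exceed the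
product of the two probabilities. -/
def correlationBound (k : ℕ) (u q : ℝ) : ℝ :=
  Real.exp (u / (1 - q) ^ 2) * (1 + u / (1 - 2 * q)) ^ k / ((1 - 2 * q) ^ (2 * k) * (1 - q) ^ 2)

lemma correlationBound_mono (k : ℕ) {u v q : ℝ} (hu : 0 ≤ u) (huv : u ≤ v) (hq : q < 1 / 2) :
    correlationBound k u q ≤ correlationBound k v q := by
  have h1 : 0 < 1 - 2 * q := by linarith
  have h2 : 0 < 1 - q := by linarith
  unfold correlationBound
  gcongr

lemma correlationBound_nonneg (k : ℕ) {u q : ℝ} (hu : 0 ≤ u) (hq : q < 1 / 2) :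
    0 ≤ correlationBound k u q := by
  have h1 : 0 < 1 - 2 * q := by linarith
  have h2 : 0 < 1 - q := by linarith
  unfold correlationBound
  positivity

/-- The probability c of being adjacent to neither root satisfies c ≤ (1-q)² + b ≤ (1-q)²
exp(b/(1-q)²), which produces the exponential factor. The sum in b/c costs a k-th power, and
replacing q/c by q costs powers of 1 - 2q. -/
lemma joint_le_correlationBound_mul {n k : ℕ} (hn : 2 ≤ n) {b q : ℝ} (hb : 0 ≤ b) (hbq : b ≤ q)
    (hq : q < 1 / 2) :
    (1 - 2 * q + b) ^ (n - 2) * truncBinomial (n - 2) k (b / (1 - 2 * q + b)) *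
        truncBinomial (n - 2) k (q / (1 - 2 * q + b)) ^ 2 ≤
      correlationBound k (n * b) q * binomialLT (n - 1) k q ^ 2 := by
  obtain ⟨m, rfl⟩ : ∃ m, n = m + 2 := ⟨n - 2, by omega⟩
  have e1 : m + 2 - 2 = m := by omega
  have e2 : m + 2 - 1 = m + 1 := by omega
  rw [e1, e2]
  set c := 1 - 2 * q + b with hc
  have hq0 : 0 ≤ q := hb.trans hbq
  have h2q : 0 < 1 - 2 * q := by linarith
  have h1q : 0 < 1 - q := by linarith
  have hcq : 1 - 2 * q ≤ c := by linarith
  have hc0 : 0 < c := by linarith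
  have hc1 : c ≤ 1 := by linarith
  set S := truncBinomial m k q with hS
  have hS0 : 0 ≤ S := truncBinomial_nonneg m k hq0
  have hpow : c ^ m ≤ (1 - q) ^ (2 * m) * Real.exp ((m + 2 : ℕ) * b / (1 - q) ^ 2) := by
    have h : c ≤ (1 - q) ^ 2 * Real.exp (b / (1 - q) ^ 2) := by
      calc c ≤ (1 - q) ^ 2 * (b / (1 - q) ^ 2 + 1) := by
            rw [mul_add, mul_div_cancel₀ _ (by positivity)]; nlinarith
        _ ≤ _ := by gcongr; exact Real.add_one_le_exp _
    calc c ^ m ≤ ((1 - q) ^ 2 * Real.exp (b / (1 - q) ^ 2)) ^ m := by gcongr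
      _ = (1 - q) ^ (2 * m) * Real.exp (m * b / (1 - q) ^ 2) := by
          rw [mul_pow, ← pow_mul, ← Real.exp_nat_mul, mul_div_assoc]
      _ ≤ _ := by gcongr; omega
  have hSb : truncBinomial m k (b / c) ≤ (1 + (m + 2 : ℕ) * b / (1 - 2 * q)) ^ k := by
    refine (truncBinomial_le m k (by positivity)).trans ?_
    rw [mul_div_assoc]
    gcongr
    omega
  have hSq : truncBinomial m k (q / c) ≤ S / (1 - 2 * q) ^ k :=
    (truncBinomial_div_le m k hq0 hc0 hc1).trans (by gcongr)
  have hπ : (1 - q) ^ (m + 1) * S ≤ binomialLT (m + 1) k q := le_binomialLT hq0 (by linarith)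
  have hSb0 : 0 ≤ truncBinomial m k (b / c) := truncBinomial_nonneg m k (by positivity)
  have hSq0 : 0 ≤ truncBinomial m k (q / c) := truncBinomial_nonneg m k (by positivity)
  calc _ ≤ ((1 - q) ^ (2 * m) * Real.exp ((m + 2 : ℕ) * b / (1 - q) ^ 2)) *
        (1 + (m + 2 : ℕ) * b / (1 - 2 * q)) ^ k * (S / (1 - 2 * q) ^ k) ^ 2 := by gcongr
    _ = correlationBound k ((m + 2 : ℕ) * b) q * ((1 - q) ^ (m + 1) * S) ^ 2 := by
      unfold correlationBound
      field_simp
      ring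
    _ ≤ _ := by
      gcongr
      exact correlationBound_nonneg k (by positivity) hq

/-! ### Pairs of nodes of the smallest class, sorted by the overlap of their rings. -/

section Joint

variable {n r P : ℕ} {μ : Fin r → ℝ} {K : Fin r → ℕ}

/-- Every class has positive weight, so each term is controlled by the mean. The constant depends on
`μ` only and thus stays fixed along the scaling. -/
lemma shareProb_le_mul_meanShareProb (hμ : ∀ i, 0 < μ i) (a : ℕ) (j : Fin r) :
    shareProb P a (K j) ≤ (∑ i, (μ i)⁻¹) * meanShareProb μ K P a := by
  have h1 : shareProb P a (K j) * μ j ≤ meanShareProb μ K P a :=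
    Finset.single_le_sum (f := fun j => shareProb P a (K j) * μ j)
      (fun i _ => mul_nonneg shareProb_nonneg (hμ i).le) (Finset.mem_univ j)
  have h2 : (μ j)⁻¹ ≤ ∑ i, (μ i)⁻¹ :=
    Finset.single_le_sum (f := fun j => (μ j)⁻¹) (fun i _ => (inv_pos.mpr (hμ i)).le)
      (Finset.mem_univ j)
  calc shareProb P a (K j) = (μ j)⁻¹ * (shareProb P a (K j) * μ j) := by
        field_simp [(hμ j).ne']
    _ ≤ _ := by
        gcongr
        · exact mul_nonneg shareProb_nonneg (hμ j).le
        · exact Finset.sum_nonneg fun i _ => (inv_pos.mpr (hμ i)).le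

lemma meanShareProb_nonneg (hμ : ∀ i, 0 ≤ μ i) (a : ℕ) : 0 ≤ meanShareProb μ K P a :=
  Finset.sum_nonneg fun i _ => mul_nonneg shareProb_nonneg (hμ i)

lemma sum_sq_shareProb_le (hμ : ∀ i, 0 < μ i) (a : ℕ) :
    ∑ j, μ j * shareProb P a (K j) ^ 2 ≤ (∑ i, (μ i)⁻¹) * meanShareProb μ K P a ^ 2 := by
  rw [sq, ← mul_assoc, meanShareProb, Finset.mul_sum]
  refine Finset.sum_le_sum fun j _ => ?_
  have h := shareProb_le_mul_meanShareProb (P := P) (K := K) hμ a j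
  calc μ j * shareProb P a (K j) ^ 2 = shareProb P a (K j) * (shareProb P a (K j) * μ j) := by ring
    _ ≤ _ := mul_le_mul_of_nonneg_right h (mul_nonneg shareProb_nonneg (hμ j).le)

lemma meetBothProb_nonneg (hμ : ∀ i, 0 ≤ μ i) (A B : Finset (Fin P)) :
    0 ≤ meetBothProb μ K P A B :=
  Finset.sum_nonneg fun i _ => mul_nonneg (hμ i) (ringProb_nonneg _)

lemma meetBothProb_le (hμ : ∀ i, 0 ≤ μ i) (hK : ∀ i, K i ≤ P) (A B : Finset (Fin P)) :
    meetBothProb μ K P A B ≤ meanShareProb μ K P A.card := by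
  refine Finset.sum_le_sum fun j _ => ?_
  rw [mul_comm, ← ringProb_hit (hK j)]
  exact mul_le_mul_of_nonneg_right (ringProb_mono fun S _ h => h.1) (hμ j)

lemma meetBothProb_le_of_disjoint (hμ : ∀ i, 0 < μ i) (hK : ∀ i, K i ≤ P) {a : ℕ}
    {A B : Finset (Fin P)} (hA : A.card = a) (hB : B.card = a) (hAB : Disjoint A B) :
    meetBothProb μ K P A B ≤ (∑ i, (μ i)⁻¹) * meanShareProb μ K P a ^ 2 := by
  refine (Finset.sum_le_sum fun j _ => ?_).trans (sum_sq_shareProb_le hμ a)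
  have := ringProb_hit_and_of_disjoint (hK j) hAB
  rw [hA, hB, ← sq] at this
  exact mul_le_mul_of_nonneg_left this (hμ j).le

lemma meetBothProb_le_of_card_inter (hμ : ∀ i, 0 < μ i) (hK : ∀ i, K i ≤ P) {a : ℕ} (ha : 2 ≤ a)
    {A B : Finset (Fin P)} (hA : A.card = a) (hB : B.card = a) (hAB : (A ∩ B).card = 1) :
    meetBothProb μ K P A B ≤
      meanShareProb μ K P a / 2 + (∑ i, (μ i)⁻¹) * meanShareProb μ K P a ^ 2 := by
  calc meetBothProb μ K P A B
      ≤ ∑ j, (shareProb P a (K j) * μ j / 2 + μ j * shareProb P a (K j) ^ 2) := by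
        refine Finset.sum_le_sum fun j _ => ?_
        calc _ ≤ μ j * (shareProb P a (K j) / 2 + shareProb P a (K j) ^ 2) :=
              mul_le_mul_of_nonneg_left (ringProb_hit_and_of_card_inter (hK j) ha hA hB hAB)
                (hμ j).le
          _ = _ := by ring
    _ = meanShareProb μ K P a / 2 + ∑ j, μ j * shareProb P a (K j) ^ 2 := by
        rw [Finset.sum_add_distrib, meanShareProb, Finset.sum_div]
    _ ≤ _ := by gcongr; exact sum_sq_shareProb_le hμ a

lemma modelMeasure_real_lowDegreeEvent_class (hμ : ∀ i, 0 ≤ μ i) (hμ_sum : ∑ i, μ i = 1)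
    (hK : ∀ i, K i ≤ P) (α : unitInterval) (i : Fin r) (k : ℕ) (x : Fin n) :
    (modelMeasure n μ K P α).real (lowDegreeEvent n {a | a.1 = i} k x) =
      μ i * binomialLT (n - 1) k (α * meanShareProb μ K P (K i)) := by
  classical
  have := isProbabilityMeasure_nodeLaw hμ hμ_sum hK
  rw [modelMeasure_real_lowDegreeEvent hμ hμ_sum hK]
  trans ∑ a : Fin r × Finset (Fin P) with a ∈ {a : Fin r × Finset (Fin P) | a.1 = i},
    (nodeLaw μ K P).real {a} * binomialLT (n - 1) k (α * meanShareProb μ K P (K i))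
  · refine Finset.sum_congr (by ext; simp) fun a ha => ?_
    rcases eq_or_ne ((nodeLaw μ K P).real {a}) 0 with h0 | h0
    · rw [h0, zero_mul, zero_mul]
    · rw [card_eq_of_nodeLaw_real_ne_zero hμ hK h0, show a.1 = i by simpa using ha]
  · rw [← Finset.sum_mul, sum_measureReal_singleton, nodeLaw_real hμ hK,
      Finset.sum_eq_single i]
    · simp [ringProb_true (hK i)]
    · intro j _ hj
      simp [hj, ringProb]
    · simp

-- The three terms come from overlaps of size 0, 1 and at least 2, each with its own bound on the
-- probability that a third node meets both rings; the coefficients bound the probabilities of the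
-- overlaps.
open Classical in
lemma modelMeasure_real_inter_le_correlationBound [NeZero r] (hμ : ∀ i, 0 < μ i)
    (hμ_sum : ∑ i, μ i = 1) (hK : ∀ i, K i ≤ P) (hK_two : 2 ≤ K 0) (α : unitInterval) (k : ℕ)
    (hs : shareProb P (K 0) (K 0) ≤ 1 / 2) {x y : Fin n} (hxy : x ≠ y) {C lam q : ℝ}
    (hC : C = ∑ i, (μ i)⁻¹) (hlam : lam = meanShareProb μ K P (K 0)) (hq : q = α * lam)
    (hq2 : q < 1 / 2) :
    (modelMeasure n μ K P α).real
        (lowDegreeEvent n {a | a.1 = 0} k x ∩ lowDegreeEvent n {a | a.1 = 0} k y) ≤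
      (μ 0 * binomialLT (n - 1) k q) ^ 2 *
        (correlationBound k (n * (C * q ^ 2)) q +
          C * lam * correlationBound k (n * (α * q / 2 + C * q ^ 2)) q +
          2 * (C * lam) ^ 2 * correlationBound k (n * (α * q)) q) := by
  have hμ' i := (hμ i).le
  have := isProbabilityMeasure_nodeLaw hμ' hμ_sum hK
  have hn : 2 ≤ n := by
    have h1 := x.2; have h2 := y.2
    have h3 : (x : ℕ) ≠ y := fun h => hxy (Fin.ext h)
    omega
  have hα0 : (0 : ℝ) ≤ α := α.2.1
  have hα1 : (α : ℝ) ≤ 1 := α.2.2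
  have hlam0 : 0 ≤ lam := hlam ▸ meanShareProb_nonneg hμ' _
  have hC0 : 0 ≤ C := hC ▸ Finset.sum_nonneg fun i _ => (inv_pos.mpr (hμ i)).le
  have hq0 : 0 ≤ q := by rw [hq]; positivity
  have hsC : shareProb P (K 0) (K 0) ≤ C * lam := by
    rw [hC, hlam]; exact shareProb_le_mul_meanShareProb hμ _ _
  set R0 := correlationBound k (n * (C * q ^ 2)) q with hR0
  set R1 := correlationBound k (n * (α * q / 2 + C * q ^ 2)) q with hR1
  set R2 := correlationBound k (n * (α * q)) q with hR2
  have hR0' : 0 ≤ R0 := correlationBound_nonneg k (by positivity) hq2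
  have hR1' : 0 ≤ R1 := correlationBound_nonneg k (by positivity) hq2
  have hR2' : 0 ≤ R2 := correlationBound_nonneg k (by positivity) hq2
  set π := binomialLT (n - 1) k q with hπ
  refine (modelMeasure_real_lowDegreeEvent_inter_le hμ' hμ_sum hK α 0 k hxy
    (by rw [← hlam, ← hq]; exact hq2)).trans ?_
  rw [← hlam, ← hq]
  set w : Fin r × Finset (Fin P) → ℝ := fun a => (nodeLaw μ K P).real {a} with hw
  have hw0 (a) : 0 ≤ w a := measureReal_nonneg
  set D : Finset (Fin r × Finset (Fin P)) := Finset.univ.filter fun a => a.1 = 0 with hD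
  have hcard {a} (ha : a ∈ D) (h : w a ≠ 0) : a.2.card = K 0 := by
    rw [card_eq_of_nodeLaw_real_ne_zero hμ' hK h, (Finset.mem_filter.mp ha).2]
  have hterm : ∀ a ∈ D, ∀ a' ∈ D,
      w a * w a' * ((1 - 2 * q + α ^ 2 * meetBothProb μ K P a.2 a'.2) ^ (n - 2) *
        truncBinomial (n - 2) k (α ^ 2 * meetBothProb μ K P a.2 a'.2 /
          (1 - 2 * q + α ^ 2 * meetBothProb μ K P a.2 a'.2)) *
        truncBinomial (n - 2) k (q / (1 - 2 * q + α ^ 2 * meetBothProb μ K P a.2 a'.2)) ^ 2) ≤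
      π ^ 2 * (w a * (R0 * w a' + R1 * (if (a'.2 ∩ a.2).Nonempty then w a' else 0) +
        R2 * (if 2 ≤ (a.2 ∩ a'.2).card then w a' else 0))) := by
    intro a ha a' ha'
    rcases eq_or_ne (w a * w a') 0 with h0 | h0
    · rw [h0, zero_mul]
      have := hw0 a; have := hw0 a'
      positivity
    have hA := hcard ha (left_ne_zero_of_mul h0)
    have hA' := hcard ha' (right_ne_zero_of_mul h0)
    have hb0 := meetBothProb_nonneg (K := K) hμ' a.2 a'.2
    have hbl := meetBothProb_le (K := K) hμ' hK a.2 a'.2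
    rw [hA, ← hlam] at hbl
    set b := meetBothProb μ K P a.2 a'.2 with hb
    have hbq : α ^ 2 * b ≤ α * q := by
      calc α ^ 2 * b ≤ α ^ 2 * lam := by gcongr
        _ = α * q := by rw [hq]; ring
    have hbq' : α ^ 2 * b ≤ q := hbq.trans (by nlinarith)
    have hmain := joint_le_correlationBound_mul (k := k) hn (by positivity) hbq' hq2
    refine (mul_le_mul_of_nonneg_left hmain (mul_nonneg (hw0 a) (hw0 a'))).trans ?_
    -- The three bounds are added instead of selected: the indicators of the events "meet" and
    -- "share two keys" need not be made disjoint.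
    have hsuff : correlationBound k (n * (α ^ 2 * b)) q ≤
        R0 + (if (a'.2 ∩ a.2).Nonempty then R1 else 0) +
          (if 2 ≤ (a.2 ∩ a'.2).card then R2 else 0) := by
      rcases Nat.lt_trichotomy (a.2 ∩ a'.2).card 1 with h | h | h
      · have hdis : Disjoint a.2 a'.2 := by
          rw [Finset.disjoint_iff_inter_eq_empty, ← Finset.card_eq_zero]; omega
        have h1 : correlationBound k (n * (α ^ 2 * b)) q ≤ R0 := by
          refine correlationBound_mono k (by positivity) ?_ hq2
          have := meetBothProb_le_of_disjoint hμ hK hA hA' hdis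
          rw [← hC, ← hlam] at this
          refine mul_le_mul_of_nonneg_left ?_ (Nat.cast_nonneg n)
          calc α ^ 2 * b ≤ α ^ 2 * (C * lam ^ 2) := by gcongr
            _ = _ := by rw [hq]; ring
        have h2 : 0 ≤ if (a'.2 ∩ a.2).Nonempty then R1 else 0 := by positivity
        have h3 : 0 ≤ if 2 ≤ (a.2 ∩ a'.2).card then R2 else 0 := by positivity
        linarith
      · have h1 : correlationBound k (n * (α ^ 2 * b)) q ≤ R1 := by
          refine correlationBound_mono k (by positivity) ?_ hq2
          have := meetBothProb_le_of_card_inter hμ hK hK_two hA hA' h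
          rw [← hC, ← hlam] at this
          refine mul_le_mul_of_nonneg_left ?_ (Nat.cast_nonneg n)
          calc α ^ 2 * b ≤ α ^ 2 * (lam / 2 + C * lam ^ 2) := by gcongr
            _ = _ := by rw [hq]; ring
        have h2 : (a'.2 ∩ a.2).Nonempty := by
          rw [Finset.inter_comm, ← Finset.card_pos]; omega
        have h3 : 0 ≤ if 2 ≤ (a.2 ∩ a'.2).card then R2 else 0 := by positivity
        rw [if_pos h2]
        linarith
      · have h1 : correlationBound k (n * (α ^ 2 * b)) q ≤ R2 :=
          correlationBound_mono k (by positivity) (by gcongr) hq2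
        have h2 : 0 ≤ if (a'.2 ∩ a.2).Nonempty then R1 else 0 := by positivity
        rw [if_pos (show 2 ≤ (a.2 ∩ a'.2).card from h)]
        linarith
    calc _ ≤ w a * w a' * ((R0 + (if (a'.2 ∩ a.2).Nonempty then R1 else 0) +
          (if 2 ≤ (a.2 ∩ a'.2).card then R2 else 0)) * π ^ 2) := by
          have := hw0 a; have := hw0 a'
          gcongr
      _ = _ := by split_ifs <;> ring
  -- For a fixed first node, summing over the second turns the overlap indicators into ring
  -- probabilities.
  have hmass (p : Finset (Fin P) → Prop) [DecidablePred p] :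
      ∑ a ∈ D, (if p a.2 then w a else 0) = μ 0 * ringProb P (K 0) p := by
    rw [← Finset.sum_filter, hw, sum_measureReal_singleton, nodeLaw_real hμ' hK,
      Finset.sum_eq_single 0]
    · congr 2
      ext S
      simp [hD]
    · intro j _ hj
      simp [hD, hj, ringProb]
    · simp
  have hmass1 : ∑ a ∈ D, w a = μ 0 := by
    simpa [ringProb_true (hK 0)] using hmass fun _ => True
  have hμ0 := hμ' 0
  calc _ = ∑ a ∈ D, ∑ a' ∈ D,
        w a * w a' * ((1 - 2 * q + α ^ 2 * meetBothProb μ K P a.2 a'.2) ^ (n - 2) *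
        truncBinomial (n - 2) k (α ^ 2 * meetBothProb μ K P a.2 a'.2 /
          (1 - 2 * q + α ^ 2 * meetBothProb μ K P a.2 a'.2)) *
        truncBinomial (n - 2) k (q / (1 - 2 * q + α ^ 2 * meetBothProb μ K P a.2 a'.2)) ^ 2) := by
        rw [← Finset.sum_product']
        refine Finset.sum_congr ?_ fun _ _ => rfl
        ext v
        simp [hD]
    _ ≤ ∑ a ∈ D, ∑ a' ∈ D, π ^ 2 * (w a * (R0 * w a' +
        R1 * (if (a'.2 ∩ a.2).Nonempty then w a' else 0) +
        R2 * (if 2 ≤ (a.2 ∩ a'.2).card then w a' else 0))) :=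
        Finset.sum_le_sum fun a ha => Finset.sum_le_sum fun a' ha' => hterm a ha a' ha'
    _ = ∑ a ∈ D, π ^ 2 * (w a * (R0 * μ 0 +
        R1 * (μ 0 * ringProb P (K 0) (fun S => (S ∩ a.2).Nonempty)) +
        R2 * (μ 0 * ringProb P (K 0) (fun S => 2 ≤ (a.2 ∩ S).card)))) := by
        refine Finset.sum_congr rfl fun a _ => ?_
        rw [← Finset.mul_sum, ← Finset.mul_sum, Finset.sum_add_distrib, Finset.sum_add_distrib,
          ← Finset.mul_sum, ← Finset.mul_sum, ← Finset.mul_sum, hmass1,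
          hmass fun S => (S ∩ a.2).Nonempty, hmass fun S => 2 ≤ (a.2 ∩ S).card]
    _ ≤ ∑ a ∈ D, π ^ 2 * (w a * (R0 * μ 0 + R1 * (μ 0 * (C * lam)) +
        R2 * (μ 0 * (2 * (C * lam) ^ 2)))) := by
        refine Finset.sum_le_sum fun a ha => ?_
        rcases eq_or_ne (w a) 0 with h0 | h0
        · simp [h0]
        have hA := hcard ha h0
        have h1 : ringProb P (K 0) (fun S => (S ∩ a.2).Nonempty) ≤ C * lam := by
          rw [ringProb_hit (hK 0), hA]; exact hsC
        have h2 : ringProb P (K 0) (fun S => 2 ≤ (a.2 ∩ S).card) ≤ 2 * (C * lam) ^ 2 := by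
          refine (ringProb_two_le_card_inter (hK 0) hs hA).trans ?_
          have : 0 ≤ shareProb P (K 0) (K 0) := shareProb_nonneg
          gcongr
        have := hw0 a
        gcongr
    _ = _ := by
        rw [← Finset.mul_sum, ← Finset.sum_mul, hmass1]
        ring

end Joint

/-! ### First and second moment bounds for the minimum degree. -/

/-- The second moment method: a bound for the probability that none of finitely many events
occurs. -/
lemma measureReal_none_le_of_second_moment {Ω ι : Type*} [MeasurableSpace Ω] [Fintype ι]
    (ν : Measure Ω) [IsProbabilityMeasure ν] (E : ι → Set Ω) (hE : ∀ x, MeasurableSet (E x))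
    (hpos : 0 < ∑ x, ν.real (E x)) :
    ν.real {ω | ∀ x, ω ∉ E x} ≤
      (∑ x, ∑ y, ν.real (E x ∩ E y)) / (∑ x, ν.real (E x)) ^ 2 - 1 := by
  set m := ∑ x, ν.real (E x) with hm
  set X : Ω → ℝ := fun ω => ∑ x, (E x).indicator 1 ω with hX
  have hi (A : Set Ω) (hA : MeasurableSet A) : Integrable (A.indicator (1 : Ω → ℝ)) ν :=
    (integrable_const (1 : ℝ)).indicator hA
  have hN : MeasurableSet {ω | ∀ x, ω ∉ E x} := by
    simp only [Set.ofPred_forall]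
    exact MeasurableSet.iInter fun x => (hE x).compl
  have hXi : Integrable X ν := integrable_finsetSum _ fun x _ => hi _ (hE x)
  have hXX (ω : Ω) : X ω ^ 2 = ∑ x, ∑ y, (E x ∩ E y).indicator 1 ω := by
    simp only [hX, sq, Finset.sum_mul_sum, Set.inter_indicator_one, Pi.mul_apply]
  have hXXi : Integrable (fun ω => X ω ^ 2) ν := by
    simp only [hXX]
    exact integrable_finsetSum _ fun x _ => integrable_finsetSum _ fun y _ =>
      hi _ ((hE x).inter (hE y))
  have hEX : ∫ ω, X ω ∂ν = m := by
    simp only [hX, hm]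
    rw [integral_finsetSum _ fun x _ => hi _ (hE x)]
    simp only [integral_indicator_one (hE _)]
  have hEXX : ∫ ω, X ω ^ 2 ∂ν = ∑ x, ∑ y, ν.real (E x ∩ E y) := by
    simp only [hXX]
    rw [integral_finsetSum _ fun x _ => integrable_finsetSum _ fun y _ =>
      hi _ ((hE x).inter (hE y))]
    refine Finset.sum_congr rfl fun x _ => ?_
    rw [integral_finsetSum _ fun y _ => hi _ ((hE x).inter (hE y))]
    simp only [integral_indicator_one ((hE _).inter (hE _))]
  have hi1 : Integrable (fun ω => 2 / m * X ω) ν := hXi.const_mul _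
  have hi2 : Integrable (fun ω => 1 - 2 / m * X ω) ν := (integrable_const _).sub hi1
  have hi3 : Integrable (fun ω => 1 / m ^ 2 * X ω ^ 2) ν := hXXi.const_mul _
  -- The indicator of X = 0 is at most (1 - X/m)².
  have hle : ∫ ω, ({ω | ∀ x, ω ∉ E x} : Set Ω).indicator 1 ω ∂ν ≤
      ∫ ω, (1 - 2 / m * X ω + 1 / m ^ 2 * X ω ^ 2) ∂ν := by
    refine integral_mono (hi _ hN) (hi2.add hi3) fun ω => ?_
    have hsq : 1 - 2 / m * X ω + 1 / m ^ 2 * X ω ^ 2 = (1 - X ω / m) ^ 2 := by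
      field_simp
      ring
    simp only [hsq]
    by_cases h : ∀ x, ω ∉ E x
    · have : X ω = 0 := Finset.sum_eq_zero fun x _ => Set.indicator_of_notMem (h x) _
      simp [Set.indicator, h, this]
    · simp only [Set.indicator, Set.mem_ofPred_eq, h, if_false]
      positivity
  rw [integral_indicator_one hN, integral_add hi2 hi3, integral_sub (integrable_const _) hi1, integral_const_mul,
    integral_const_mul, hEX, hEXX] at hle
  simp only [integral_const, probReal_univ, smul_eq_mul] at hle
  refine hle.trans (le_of_eq ?_)
  field_simp
  ring

section MinDegree

variable {n r P : ℕ} {μ : Fin r → ℝ} {K : Fin r → ℕ}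

open Classical in
lemma probMinDegreeGE_le [NeZero r] (hμ : ∀ i, 0 < μ i) (hμ_sum : ∑ i, μ i = 1)
    (hK : ∀ i, K i ≤ P) (α : unitInterval) (k : ℕ) {p B : ℝ} (hn : 0 < n) (hB : 0 ≤ B)
    (hp : p = μ 0 * binomialLT (n - 1) k (α * meanShareProb μ K P (K 0))) (hp0 : 0 < p)
    (hpair : ∀ x y : Fin n, x ≠ y → (modelMeasure n μ K P α).real
      (lowDegreeEvent n {a | a.1 = 0} k x ∩ lowDegreeEvent n {a | a.1 = 0} k y) ≤ p ^ 2 * B) :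
    probMinDegreeGE n μ K P α k ≤ 1 / (n * p) + B - 1 := by
  have := isProbabilityMeasure_modelMeasure (n := n) (fun i => (hμ i).le) hμ_sum hK α
  set E : Fin n → Set ((Fin n → Fin r × Finset (Fin P)) × SimpleGraph (Fin n)) :=
    fun x => lowDegreeEvent n {a | a.1 = 0} k x with hE
  have hEp (x : Fin n) : (modelMeasure n μ K P α).real (E x) = p := by
    rw [hp, ← modelMeasure_real_lowDegreeEvent_class (fun i => (hμ i).le) hμ_sum hK]
  have hsum : ∑ x, (modelMeasure n μ K P α).real (E x) = n * p := by
    simp [hEp]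
  have hn' : (0 : ℝ) < n := by exact_mod_cast hn
  have hnp : 0 < n * p := by positivity
  have h2 := measureReal_none_le_of_second_moment (modelMeasure n μ K P α) E
    (fun _ => .of_discrete) (by rw [hsum]; exact hnp)
  have h1 : probMinDegreeGE n μ K P α k ≤
      (modelMeasure n μ K P α).real {ω | ∀ x, ω ∉ E x} := by
    refine measureReal_mono (fun ω hω x hx => ?_) (measure_ne_top _ _)
    have h3 : k ≤ (interGraph ω).minDegree := hω
    have h4 := (interGraph ω).minDegree_le_degree x
    have h5 := hx.2
    omega
  refine h1.trans (h2.trans ?_)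
  rw [hsum]
  have hrow (x : Fin n) : ∑ y, (modelMeasure n μ K P α).real (E x ∩ E y) ≤
      p + n * (p ^ 2 * B) := by
    rw [← Finset.add_sum_erase _ _ (Finset.mem_univ x), Set.inter_self, hEp]
    gcongr
    calc _ ≤ ∑ y ∈ Finset.univ.erase x, p ^ 2 * B :=
          Finset.sum_le_sum fun y hy => hpair x y (Finset.ne_of_mem_erase hy).symm
      _ ≤ ∑ y : Fin n, p ^ 2 * B :=
          Finset.sum_le_sum_of_subset_of_nonneg (Finset.erase_subset _ _)
            fun _ _ _ => by positivity
      _ = _ := by simp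
  have htot : ∑ x, ∑ y, (modelMeasure n μ K P α).real (E x ∩ E y) ≤
      n * (p + n * (p ^ 2 * B)) :=
    (Finset.sum_le_sum fun x _ => hrow x).trans (by simp [mul_add])
  calc _ ≤ n * (p + n * (p ^ 2 * B)) / (n * p) ^ 2 - 1 := by gcongr
    _ = _ := by field_simp

-- A union bound over nodes of all classes. Larger rings only raise the edge probability, so `hε` is
-- required for every `q` above the value of the smallest class.
open Classical in
lemma le_probMinDegreeGE [NeZero r] (hμ : ∀ i, 0 ≤ μ i) (hμ_sum : ∑ i, μ i = 1)
    (hK : ∀ i, K i ≤ P) (hK_mono : Monotone K) (α : unitInterval) (k : ℕ) {ε : ℝ} (hn : 0 < n)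
    (hε : ∀ q, α * meanShareProb μ K P (K 0) ≤ q → q ≤ 1 → binomialLT (n - 1) k q ≤ ε) :
    1 - n * ε ≤ probMinDegreeGE n μ K P α k := by
  have := isProbabilityMeasure_modelMeasure (n := n) hμ hμ_sum hK α
  have := isProbabilityMeasure_nodeLaw hμ hμ_sum hK
  have hα0 : (0 : ℝ) ≤ α := α.2.1
  have hα1 : (α : ℝ) ≤ 1 := α.2.2
  have : Nonempty (Fin n) := ⟨⟨0, hn⟩⟩
  have hx (x : Fin n) : (modelMeasure n μ K P α).real (lowDegreeEvent n Set.univ k x) ≤ ε := by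
    rw [modelMeasure_real_lowDegreeEvent hμ hμ_sum hK]
    calc _ ≤ ∑ a : Fin r × Finset (Fin P), (nodeLaw μ K P).real {a} * ε := by
          simp only [Set.mem_univ, Finset.filter_true]
          refine Finset.sum_le_sum fun a _ => ?_
          rcases eq_or_ne ((nodeLaw μ K P).real {a}) 0 with h0 | h0
          · simp [h0]
          refine mul_le_mul_of_nonneg_left (hε _ ?_ ?_) measureReal_nonneg
          · rw [card_eq_of_nodeLaw_real_ne_zero hμ hK h0]
            refine mul_le_mul_of_nonneg_left (Finset.sum_le_sum fun j _ => ?_) hα0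
            exact mul_le_mul_of_nonneg_right (shareProb_mono (hK_mono (Fin.zero_le _))) (hμ j)
          · have h1 : meanShareProb μ K P a.2.card ≤ 1 := by
              rw [← nodeLaw_real_meets hμ hK]; exact measureReal_le_one
            exact mul_le_one₀ hα1 (meanShareProb_nonneg hμ _) h1
      _ = ε := by
          rw [← Finset.sum_mul, sum_measureReal_singleton]
          simp
  have hcompl : {ω | k ≤ (interGraph ω).minDegree}ᶜ ⊆
      ⋃ x ∈ (Finset.univ : Finset (Fin n)), lowDegreeEvent (r := r) (P := P) n Set.univ k x := by
    intro ω hω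
    simp only [Set.mem_compl_iff, Set.mem_ofPred_eq, not_le] at hω
    obtain ⟨x, hx⟩ := (interGraph ω).exists_minimal_degree_vertex
    simp only [Set.mem_iUnion, Finset.mem_univ, exists_prop, true_and]
    exact ⟨x, trivial, hx ▸ hω⟩
  have h1 := measureReal_mono (μ := modelMeasure n μ K P α) hcompl (measure_ne_top _ _)
  rw [probReal_compl_eq_one_sub .of_discrete] at h1
  have h2 := h1.trans ((measureReal_biUnion_finset_le _ _).trans
    (Finset.sum_le_sum fun x _ => hx x))
  simp only [Finset.sum_const, Finset.card_univ, Fintype.card_fin, nsmul_eq_mul] at h2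
  unfold probMinDegreeGE
  linarith

end MinDegree

/-! ### Upper bound for the mean number of nodes of small degree, and part (b). -/

lemma binomialLT_le_exp {n j : ℕ} (hn : 1 ≤ n) {q : ℝ} (hq : 0 ≤ q) (hq1 : q ≤ 1) :
    binomialLT (n - 1) (j + 1) q ≤
      Real.exp (j + 1) * Real.exp (-(n * q)) * (1 + n * q) ^ j := by
  have hy : 0 ≤ n * q := by positivity
  calc binomialLT (n - 1) (j + 1) q
      ≤ ∑ l ∈ Finset.range (j + 1),
          Real.exp (j + 1) * Real.exp (-(n * q)) * (n * q) ^ l := by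
        refine Finset.sum_le_sum fun l hl => ?_
        have h1 : (((n - 1).choose l : ℕ) : ℝ) ≤ (n : ℝ) ^ l := by
          refine (Nat.cast_le.mpr (Nat.choose_le_pow (n - 1) l)).trans ?_
          push_cast
          gcongr
          omega
        have h2 : (1 - q) ^ (n - 1 - l) ≤ Real.exp (j + 1) * Real.exp (-(n * q)) := by
          calc (1 - q) ^ (n - 1 - l) ≤ Real.exp (-q) ^ (n - 1 - l) :=
                pow_le_pow_left₀ (by linarith) (Real.one_sub_le_exp_neg q) _
            _ = Real.exp (((n - 1 - l : ℕ) : ℝ) * -q) := by rw [Real.exp_nat_mul]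
            _ ≤ Real.exp ((j + 1) + -(n * q)) := by
                apply Real.exp_le_exp.mpr
                have h3 : (n : ℝ) ≤ (n - 1 - l : ℕ) + (j + 1) := by
                  have := Finset.mem_range.mp hl
                  have h4 : n ≤ (n - 1 - l) + (j + 1) := by omega
                  exact_mod_cast h4
                nlinarith
            _ = _ := Real.exp_add _ _
        have h3 : 0 ≤ (1 - q) ^ (n - 1 - l) := pow_nonneg (by linarith) _
        calc (((n - 1).choose l : ℕ) : ℝ) * (q ^ l * (1 - q) ^ (n - 1 - l))
            ≤ (n : ℝ) ^ l * (q ^ l * (Real.exp (j + 1) * Real.exp (-(n * q)))) := by gcongr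
          _ = _ := by rw [mul_pow]; ring
    _ = Real.exp (j + 1) * Real.exp (-(n * q)) * ∑ l ∈ Finset.range (j + 1), (n * q) ^ l := by
        rw [Finset.mul_sum]
    _ ≤ _ := by
        gcongr
        exact geom_sum_le_one_add_pow hy j

/-- The identity `n e^{-t} = (log n)^{-j} e^{-g}` for `t = log n + j log log n + g`. -/
lemma mul_exp_neg_eq {n j : ℕ} (hn : 0 < n) (hL : 0 < Real.log n) {t g : ℝ}
    (ht : t = Real.log n + j * Real.log (Real.log n) + g) :
    n * Real.exp (-t) * Real.log n ^ j = Real.exp (-g) := by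
  have hn' : (0 : ℝ) < n := by exact_mod_cast hn
  have e1 : (n : ℝ) = Real.exp (Real.log n) := (Real.exp_log hn').symm
  have e2 : Real.log n ^ j = Real.exp (j * Real.log (Real.log n)) := by
    rw [Real.exp_nat_mul, Real.exp_log hL]
  calc n * Real.exp (-t) * Real.log n ^ j
      = Real.exp (Real.log n) * Real.exp (-t) * Real.exp (j * Real.log (Real.log n)) := by
        rw [← e1, ← e2]
    _ = _ := by rw [← Real.exp_add, ← Real.exp_add, ht]; ring_nf

/-- As 1 + nq ≤ (j + 2 + g) log n, the powers of log n cancel. The bound is free of n, which makes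
it uniform over the classes, whose excess g may be arbitrarily large. -/
lemma mul_binomialLT_le {n j : ℕ} (hn : 1 ≤ n) (hL : 1 ≤ Real.log n) {q g : ℝ} (hq : 0 ≤ q)
    (hq1 : q ≤ 1) (hg : 0 ≤ g) (ht : n * q = Real.log n + j * Real.log (Real.log n) + g) :
    n * binomialLT (n - 1) (j + 1) q ≤
      Real.exp (j + 1) * ((j + 2 + g) ^ j * Real.exp (-g)) := by
  have hid := mul_exp_neg_eq (by omega) (by linarith) ht
  have hLL : Real.log (Real.log n) ≤ Real.log n := by
    have := Real.log_le_sub_one_of_pos (show 0 < Real.log n by linarith)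
    linarith
  have h1 : 1 + n * q ≤ Real.log n * (j + 2 + g) := by
    rw [ht]
    have : (j : ℝ) * Real.log (Real.log n) ≤ j * Real.log n := by gcongr
    nlinarith
  have h0 : 0 ≤ n * q := by positivity
  calc n * binomialLT (n - 1) (j + 1) q
      ≤ n * (Real.exp (j + 1) * Real.exp (-(n * q)) * (1 + n * q) ^ j) := by
        gcongr
        exact binomialLT_le_exp hn hq hq1
    _ ≤ n * (Real.exp (j + 1) * Real.exp (-(n * q)) * (Real.log n * (j + 2 + g)) ^ j) := by
        gcongr
    _ = Real.exp (j + 1) * ((j + 2 + g) ^ j *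
          (n * Real.exp (-(n * q)) * Real.log n ^ j)) := by rw [mul_pow]; ring
    _ = _ := by rw [hid]

lemma tendsto_pow_add_mul_exp_neg (j : ℕ) :
    Tendsto (fun g : ℝ => Real.exp (j + 1) * ((j + 2 + g) ^ j * Real.exp (-g))) atTop (𝓝 0) := by
  have h1 : Tendsto (fun g : ℝ => (j + 2 : ℝ) + g) atTop atTop :=
    tendsto_atTop_add_const_left _ _ tendsto_id
  have h2 := ((Real.tendsto_pow_mul_exp_neg_atTop_nhds_zero j).comp h1).const_mul
    (Real.exp (j + 1) * Real.exp (j + 2))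
  rw [mul_zero] at h2
  refine h2.congr fun g => ?_
  simp only [Function.comp]
  have : Real.exp (j + 2) * Real.exp (-(j + 2 + g)) = Real.exp (-g) := by
    rw [← Real.exp_add]
    ring_nf
  rw [← this]
  ring

lemma tendsto_log_natCast : Tendsto (fun n : ℕ => Real.log n) atTop atTop :=
  Real.tendsto_log_atTop.comp tendsto_natCast_atTop_atTop

theorem tendsto_probMinDegreeGE_one {r : ℕ} [NeZero r] {μ : Fin r → ℝ} (hμ_pos : ∀ i, 0 < μ i)
    (hμ_sum : ∑ i, μ i = 1) {K : ℕ → Fin r → ℕ} {P : ℕ → ℕ} {α : ℕ → unitInterval}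
    (hK_mono : ∀ n, 2 ≤ n → Monotone (K n)) (hK : ∀ n, 2 ≤ n → ∀ i, K n i ≤ P n)
    (j : ℕ) {γ : ℕ → ℝ}
    (hγ : ∀ n : ℕ, 2 ≤ n → n * ((α n : ℝ) * meanShareProb μ (K n) (P n) (K n 0)) =
        Real.log n + j * Real.log (Real.log n) + γ n)
    (hlim : Tendsto γ atTop atTop) :
    Tendsto (fun n => probMinDegreeGE n μ (K n) (P n) (α n) (j + 1)) atTop (𝓝 1) := by
  have hμ i := (hμ_pos i).le
  have hlower : ∀ ε > 0, ∀ᶠ n in atTop,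
      1 - ε ≤ probMinDegreeGE n μ (K n) (P n) (α n) (j + 1) := by
    intro ε hε
    obtain ⟨X, hX⟩ := eventually_atTop.mp ((tendsto_pow_add_mul_exp_neg j).eventually_lt_const hε)
    filter_upwards [eventually_ge_atTop 2, hlim.eventually_ge_atTop (max X 0),
      tendsto_log_natCast.eventually_ge_atTop 1] with n hn hγn hL
    have hn0 : (0 : ℝ) < n := by exact_mod_cast (by omega : 0 < n)
    have key := le_probMinDegreeGE (n := n) hμ hμ_sum (hK n hn) (hK_mono n hn) (α n) (j + 1)
      (ε := ε / n) (by omega) ?_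
    · rwa [mul_div_cancel₀ _ hn0.ne'] at key
    · intro q hq hq1
      have hq0 : 0 ≤ q := le_trans (mul_nonneg (α n).2.1 (meanShareProb_nonneg hμ _)) hq
      -- The excess belonging to `q`; it is at least `γ n`, hence past the threshold `X`.
      set g := n * q - (Real.log n + j * Real.log (Real.log n)) with hg
      have hgγ : γ n ≤ g := by
        have := mul_le_mul_of_nonneg_left hq hn0.le
        rw [hγ n hn] at this
        linarith
      have hb := mul_binomialLT_le (j := j) (by omega) hL hq0 hq1
        ((le_max_right _ _).trans (hγn.trans hgγ)) (show n * q = _ + g by rw [hg]; ring)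
      rw [le_div_iff₀' hn0]
      exact hb.trans (hX g ((le_max_left _ _).trans (hγn.trans hgγ))).le
  have hupper n (hn : 2 ≤ n) : probMinDegreeGE n μ (K n) (P n) (α n) (j + 1) ≤ 1 := by
    have := isProbabilityMeasure_modelMeasure (n := n) hμ hμ_sum (hK n hn) (α n)
    exact measureReal_le_one
  rw [Metric.tendsto_atTop']
  intro ε hε
  obtain ⟨N, hN⟩ := eventually_atTop.mp ((hlower (ε / 2) (by linarith)).and
    (eventually_ge_atTop 2))
  refine ⟨N, fun n hn => ?_⟩
  obtain ⟨h1, h2⟩ := hN n hn.le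
  rw [Real.dist_eq, abs_lt]
  constructor <;> linarith [hupper n h2]

/-! ### The lower bound for the mean number of nodes of small degree -/

lemma exp_neg_le_one_sub {q : ℝ} (hq2 : q ≤ 1 / 2) :
    Real.exp (-(q + 2 * q ^ 2)) ≤ 1 - q := by
  have h0 : 0 < 1 - q := by linarith
  rw [← Real.le_log_iff_exp_le h0]
  refine le_trans ?_ (Real.one_sub_inv_le_log_of_pos h0)
  rw [neg_le_iff_add_nonneg, ← sub_le_iff_le_add, zero_sub, neg_le, neg_sub, inv_eq_one_div,
    sub_le_iff_le_add, div_le_iff₀ h0]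
  nlinarith

lemma truncBinomial_ge {N j : ℕ} {x : ℝ} (hx : 0 ≤ x) {l : ℕ} (hl : l ≤ j) :
    (N.choose l : ℝ) * x ^ l ≤ truncBinomial N (j + 1) x :=
  Finset.single_le_sum (f := fun l => (N.choose l : ℝ) * x ^ l) (fun _ _ => by positivity)
    (Finset.mem_range.mpr (by omega))

/-- Since g may be very negative, nq need not be of order log n. If nq ≤ (log n)/2, the term of
degree 0 already gives order √n. Otherwise the term of degree j supplies (log n)^j, which cancels
the (log n)^{-j} in n exp(-nq). The factor exp(-1) pays for replacing 1 - q by exp(-q). -/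
lemma min_le_mul_binomialLT {n j : ℕ} (hn : 2 * (j + 1) ≤ n) (hL : 0 < Real.log n) {q g : ℝ}
    (hq : 0 ≤ q) (hq2 : q ≤ 1 / 2) (hnq : 2 * (n * q ^ 2) ≤ 1)
    (ht : n * q = Real.log n + j * Real.log (Real.log n) + g) :
    min (Real.exp (-1) * Real.exp (Real.log n / 2))
      (Real.exp (-1) * Real.exp (-g) / (4 ^ j * j.factorial)) ≤
        n * binomialLT (n - 1) (j + 1) q := by
  obtain ⟨m, rfl⟩ : ∃ m, n = m + 2 := ⟨n - 2, by omega⟩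
  set n := m + 2 with hn_def
  have hn0 : (0 : ℝ) < n := by positivity
  have hb : (1 - q) ^ (m + 1) * truncBinomial m (j + 1) q ≤ binomialLT (n - 1) (j + 1) q :=
    le_binomialLT hq (by linarith)
  have hpow : Real.exp (-1) * Real.exp (-(n * q)) ≤ (1 - q) ^ (m + 1) := by
    calc Real.exp (-1) * Real.exp (-(n * q)) ≤ Real.exp (n * -(q + 2 * q ^ 2)) := by
          rw [← Real.exp_add]
          apply Real.exp_le_exp.mpr
          nlinarith
      _ = Real.exp (-(q + 2 * q ^ 2)) ^ n := Real.exp_nat_mul _ _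
      _ ≤ (1 - q) ^ n := by gcongr; exact exp_neg_le_one_sub hq2
      _ ≤ (1 - q) ^ (m + 1) := pow_le_pow_of_le_one (by linarith) (by linarith) (by omega)
  have hmain (s : ℝ) (hs0 : 0 ≤ s) (hs : s ≤ truncBinomial m (j + 1) q) :
      n * (Real.exp (-1) * Real.exp (-(n * q)) * s) ≤ n * binomialLT (n - 1) (j + 1) q := by
    have h1 : 0 ≤ (1 - q) ^ (m + 1) := pow_nonneg (by linarith) _
    exact mul_le_mul_of_nonneg_left ((mul_le_mul hpow hs hs0 h1).trans hb) hn0.le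
  rcases le_total (n * q) (Real.log n / 2) with h | h
  · refine (min_le_left _ _).trans (le_trans ?_ (hmain 1 zero_le_one ?_))
    · have e : (n : ℝ) = Real.exp (Real.log n) := (Real.exp_log hn0).symm
      calc Real.exp (-1) * Real.exp (Real.log n / 2)
          ≤ Real.exp (-1) * Real.exp (Real.log n - n * q) := by gcongr; linarith
        _ = Real.exp (Real.log n) * (Real.exp (-1) * Real.exp (-(n * q)) * 1) := by
            rw [sub_eq_add_neg, Real.exp_add]; ring
        _ = _ := by rw [← e]
    · simpa using truncBinomial_ge (N := m) hq (Nat.zero_le j)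
  · refine (min_le_right _ _).trans (le_trans ?_ (hmain ((Real.log n / 4) ^ j / j.factorial)
      (by positivity) ?_))
    · have hid := mul_exp_neg_eq (by omega) hL ht
      rw [← hid, div_pow]
      apply le_of_eq
      field_simp
    · refine le_trans ?_ (truncBinomial_ge (N := m) hq le_rfl)
      have h1 := Nat.pow_le_choose (α := ℝ) j m
      -- This loses one factor 2, and the case assumption on nq the other; together they make the 4
      -- in the bound.
      have h2 : (n : ℝ) / 2 ≤ ((m + 1 - j : ℕ) : ℝ) := by
        rw [div_le_iff₀ (by norm_num)]
        have : n ≤ (m + 1 - j) * 2 := by omega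
        exact_mod_cast this
      calc (Real.log n / 4) ^ j / j.factorial ≤ (n / 2 * q) ^ j / j.factorial := by
            gcongr; linarith
        _ = (n / 2) ^ j / j.factorial * q ^ j := by rw [mul_pow]; ring
        _ ≤ ((m + 1 - j : ℕ) : ℝ) ^ j / j.factorial * q ^ j := by gcongr
        _ ≤ _ := by gcongr

/-! ### Negligibility of overlapping pairs, and part (a). -/

/-- Two bounds on u are allowed because the exponent needs a sharp constant while the polynomial
factor does not. For q ≤ 1/20 one has (1-q)² ≥ 9/10, whence 10/9. -/
lemma correlationBound_le {k : ℕ} {u v w q : ℝ} (hu : 0 ≤ u) (huv : u ≤ v) (huw : u ≤ w)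
    (hq : q ≤ 1 / 20) :
    correlationBound k u q ≤ 4 ^ (k + 1) * Real.exp (10 / 9 * v) * (1 + 2 * w) ^ k := by
  have h2 : 1 / 2 ≤ 1 - 2 * q := by linarith
  have h1 : 1 / 2 ≤ 1 - q := by linarith
  have hden : (1 / 4 : ℝ) ^ (k + 1) ≤ (1 - 2 * q) ^ (2 * k) * (1 - q) ^ 2 := by
    calc (1 / 4 : ℝ) ^ (k + 1) = (1 / 2) ^ (2 * k) * (1 / 2) ^ 2 := by
          rw [pow_succ, pow_mul]; norm_num
      _ ≤ _ := by gcongr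
  have he : u / (1 - q) ^ 2 ≤ 10 / 9 * v := by
    rw [div_le_iff₀ (by positivity)]
    have : 9 / 10 ≤ (1 - q) ^ 2 := by nlinarith
    nlinarith
  have hw : u / (1 - 2 * q) ≤ 2 * w := by
    rw [div_le_iff₀ (by linarith)]
    nlinarith
  have h3 : 0 ≤ u / (1 - 2 * q) := div_nonneg hu (by linarith)
  have hw0 : 0 ≤ w := hu.trans huw
  unfold correlationBound
  calc _ ≤ Real.exp (10 / 9 * v) * (1 + 2 * w) ^ k / (1 / 4) ^ (k + 1) := by
        gcongr
    _ = _ := by rw [one_div, inv_pow, div_inv_eq_mul]; ring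

lemma correlation_remainder_le {n k : ℕ} {C lam q a : ℝ} (hC : 0 ≤ C) (hlam : 0 ≤ lam)
    (ha : 0 ≤ a) (ha1 : a ≤ 1) (hq : q = a * lam) (hq20 : q ≤ 1 / 20) (hn : 0 < n)
    (hL : 1 ≤ Real.log n) (ht : n * q ≤ 11 / 10 * Real.log n) (hC1 : n * (C * q ^ 2) ≤ 1) :
    C * lam * correlationBound k (n * (a * q / 2 + C * q ^ 2)) q +
        2 * (C * lam) ^ 2 * correlationBound k (n * (a * q)) q ≤
      (C * lam + 2 * (C * lam) ^ 2) * (4 ^ (k + 1) * Real.exp (10 / 3) * 7 ^ k) +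
        2 * C * 4 ^ (k + 1) * Real.exp (10 / 9) * 7 ^ k *
          (Real.log n ^ (k + 2) * Real.exp (-(7 / 18 * Real.log n))) +
        8 * C ^ 2 * 4 ^ (k + 1) * 7 ^ k *
          (Real.log n ^ (k + 4) * Real.exp (-(7 / 18 * Real.log n))) := by
  set L := Real.log n with hLdef
  have hn0 : (0 : ℝ) < n := by exact_mod_cast hn
  have hq0 : 0 ≤ q := hq ▸ mul_nonneg ha hlam
  have hL0 : 0 ≤ L := by linarith
  have hu1 : 0 ≤ n * (a * q / 2 + C * q ^ 2) := by positivity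
  have hu2 : 0 ≤ n * (a * q) := by positivity
  have e1 : n * (a * q / 2 + C * q ^ 2) = a * (n * q) / 2 + n * (C * q ^ 2) := by ring
  have e2 : n * (a * q) = a * (n * q) := by ring
  have hat : a * (n * q) ≤ 11 / 10 * (a * L) := by
    calc a * (n * q) ≤ a * (11 / 10 * L) := by gcongr
      _ = _ := by ring
  -- If aL ≤ 1, both arguments of `correlationBound` are at most 3 and smallness comes from `lam`.
  -- If aL > 1, then lam = q/a < qL forces `lam` to be of order L²/n.
  rcases le_or_gt (a * L) 1 with hcase | hcase
  · have hR (u : ℝ) (hu0 : 0 ≤ u) (hu : u ≤ 3) :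
        correlationBound k u q ≤ 4 ^ (k + 1) * Real.exp (10 / 3) * 7 ^ k := by
      have := correlationBound_le (k := k) hu0 hu hu hq20
      norm_num at this ⊢
      exact this
    have h1 := hR _ hu1 (by rw [e1]; linarith)
    have h2 := hR _ hu2 (by rw [e2]; linarith)
    have h3 : 0 ≤ 2 * C * 4 ^ (k + 1) * Real.exp (10 / 9) * 7 ^ k *
          (L ^ (k + 2) * Real.exp (-(7 / 18 * L))) := by positivity
    have h4 : 0 ≤ 8 * C ^ 2 * 4 ^ (k + 1) * 7 ^ k *
          (L ^ (k + 4) * Real.exp (-(7 / 18 * L))) := by positivity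
    have h5 : C * lam * correlationBound k (n * (a * q / 2 + C * q ^ 2)) q ≤
        C * lam * (4 ^ (k + 1) * Real.exp (10 / 3) * 7 ^ k) := by gcongr
    have h6 : 2 * (C * lam) ^ 2 * correlationBound k (n * (a * q)) q ≤
        2 * (C * lam) ^ 2 * (4 ^ (k + 1) * Real.exp (10 / 3) * 7 ^ k) := by gcongr
    linarith
  · have haL : a * L ≤ L := by nlinarith
    have hlam_le : lam ≤ 2 * L ^ 2 * Real.exp (-L) := by
      have h1 : lam ≤ q * L := by rw [hq]; nlinarith
      have h2 : Real.exp (-L) = 1 / n := by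
        rw [Real.exp_neg, hLdef, Real.exp_log hn0, one_div]
      rw [h2, mul_one_div, le_div_iff₀ hn0]
      calc lam * n ≤ q * L * n := by gcongr
        _ = n * q * L := by ring
        _ ≤ 11 / 10 * L * L := by gcongr
        _ ≤ _ := by nlinarith
    have hpow : (1 + 2 * (3 * L)) ^ k ≤ (7 * L) ^ k := by
      gcongr
      linarith
    have h1 := correlationBound_le (k := k) (v := 11 / 20 * L + 1) (w := 3 * L) hu1
      (by rw [e1]; linarith) (by rw [e1]; linarith) hq20
    have h2 := correlationBound_le (k := k) (v := 11 / 10 * L) (w := 3 * L) hu2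
      (by rw [e2]; linarith) (by rw [e2]; linarith) hq20
    have hR1 := correlationBound_nonneg k hu1 (show q < 1 / 2 by linarith)
    have hR2 := correlationBound_nonneg k hu2 (show q < 1 / 2 by linarith)
    -- The exponent of n is -1 + (10/9)(11/20) = -7/18. Without the half in the overlap bound it
    -- would be positive.
    have h3 : C * lam * correlationBound k (n * (a * q / 2 + C * q ^ 2)) q ≤
        2 * C * 4 ^ (k + 1) * Real.exp (10 / 9) * 7 ^ k *
          (L ^ (k + 2) * Real.exp (-(7 / 18 * L))) := by
      calc _ ≤ C * (2 * L ^ 2 * Real.exp (-L)) *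
            (4 ^ (k + 1) * Real.exp (10 / 9 * (11 / 20 * L + 1)) * (7 * L) ^ k) := by
            gcongr
            exact h1.trans (by gcongr)
        _ = 2 * C * 4 ^ (k + 1) * 7 ^ k * L ^ (k + 2) *
              (Real.exp (-L) * Real.exp (10 / 9 * (11 / 20 * L + 1))) := by
            rw [mul_pow]; ring
        _ = 2 * C * 4 ^ (k + 1) * 7 ^ k * L ^ (k + 2) *
              (Real.exp (10 / 9) * Real.exp (-(7 / 18 * L))) := by
            rw [← Real.exp_add, ← Real.exp_add]; ring_nf
        _ = _ := by ring
    -- Here the exponent is -2 + (10/9)(11/10) = -7/9, weakened to -7/18 for a common form.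
    have h4 : 2 * (C * lam) ^ 2 * correlationBound k (n * (a * q)) q ≤
        8 * C ^ 2 * 4 ^ (k + 1) * 7 ^ k *
          (L ^ (k + 4) * Real.exp (-(7 / 18 * L))) := by
      calc _ ≤ 2 * (C * (2 * L ^ 2 * Real.exp (-L))) ^ 2 *
            (4 ^ (k + 1) * Real.exp (10 / 9 * (11 / 10 * L)) * (7 * L) ^ k) := by
            gcongr
            exact h2.trans (by gcongr)
        _ = 8 * C ^ 2 * 4 ^ (k + 1) * 7 ^ k * L ^ (k + 4) *
              (Real.exp (-L) * Real.exp (-L) * Real.exp (10 / 9 * (11 / 10 * L))) := by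
            rw [mul_pow]; ring
        _ ≤ 8 * C ^ 2 * 4 ^ (k + 1) * 7 ^ k * L ^ (k + 4) * Real.exp (-(7 / 18 * L)) := by
            rw [← Real.exp_add, ← Real.exp_add]
            gcongr
            linarith
        _ = _ := by ring
    have h5 : 0 ≤ (C * lam + 2 * (C * lam) ^ 2) * (4 ^ (k + 1) * Real.exp (10 / 3) * 7 ^ k) := by
      positivity
    linarith

lemma tendsto_pow_mul_exp_neg_mul (s : ℕ) {c : ℝ} (hc : 0 < c) :
    Tendsto (fun x : ℝ => x ^ s * Real.exp (-(c * x))) atTop (𝓝 0) := by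
  simpa using tendsto_rpow_mul_exp_neg_mul_atTop_nhds_zero s c hc

lemma tendsto_correlationBound (k : ℕ) {u q : ℕ → ℝ} (hu : Tendsto u atTop (𝓝 0))
    (hq : Tendsto q atTop (𝓝 0)) :
    Tendsto (fun n => correlationBound k (u n) (q n)) atTop (𝓝 1) := by
  have h1 : Tendsto (fun n => 1 - q n) atTop (𝓝 1) := by simpa using hq.const_sub 1
  have h2 : Tendsto (fun n => 1 - 2 * q n) atTop (𝓝 1) := by simpa using (hq.const_mul 2).const_sub 1
  have h3 : Tendsto (fun n => Real.exp (u n / (1 - q n) ^ 2)) atTop (𝓝 1) := by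
    have := (hu.div (h1.pow 2) (by norm_num)).rexp
    simpa using this
  have h4 : Tendsto (fun n => (1 + u n / (1 - 2 * q n)) ^ k) atTop (𝓝 1) := by
    have := (((hu.div h2 (by norm_num)).const_add 1).pow k)
    simpa using this
  have h5 : Tendsto (fun n => (1 - 2 * q n) ^ (2 * k) * (1 - q n) ^ 2) atTop (𝓝 1) := by
    simpa using (h2.pow (2 * k)).mul (h1.pow 2)
  have h := (h3.mul h4).div h5 (by norm_num)
  rw [mul_one, div_one] at h
  exact h

theorem tendsto_probMinDegreeGE_zero {r : ℕ} [NeZero r] {μ : Fin r → ℝ} (hμ : ∀ i, 0 < μ i)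
    (hμ_sum : ∑ i, μ i = 1) {K : ℕ → Fin r → ℕ} {P : ℕ → ℕ} {α : ℕ → unitInterval}
    (hK_two : ∀ n, 2 ≤ n → 2 ≤ K n 0) (hK : ∀ n, 2 ≤ n → ∀ i, K n i ≤ P n)
    (j : ℕ) {γ : ℕ → ℝ}
    (hγ : ∀ n : ℕ, 2 ≤ n → n * ((α n : ℝ) * meanShareProb μ (K n) (P n) (K n 0)) =
        Real.log n + j * Real.log (Real.log n) + γ n)
    (hlam : Tendsto (fun n => meanShareProb μ (K n) (P n) (K n 0)) atTop (𝓝 0))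
    (hlim : Tendsto γ atTop atBot) :
    Tendsto (fun n => probMinDegreeGE n μ (K n) (P n) (α n) (j + 1)) atTop (𝓝 0) := by
  classical
  have hμ' i := (hμ i).le
  set lam : ℕ → ℝ := fun n => meanShareProb μ (K n) (P n) (K n 0) with hlam_def
  set q : ℕ → ℝ := fun n => α n * lam n with hq_def
  set C : ℝ := ∑ i, (μ i)⁻¹ with hC_def
  have hC0 : 0 ≤ C := Finset.sum_nonneg fun i _ => (inv_pos.mpr (hμ i)).le
  have hlam0 n : 0 ≤ lam n := meanShareProb_nonneg hμ' _
  have hα0 n : (0 : ℝ) ≤ α n := (α n).2.1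
  have hα1 n : (α n : ℝ) ≤ 1 := (α n).2.2
  have hq0 n : 0 ≤ q n := mul_nonneg (hα0 n) (hlam0 n)
  have hqlam n : q n ≤ lam n := mul_le_of_le_one_left (hlam0 n) (hα1 n)
  have hq_lim : Tendsto q atTop (𝓝 0) := squeeze_zero hq0 hqlam hlam
  have hlog := tendsto_log_natCast
  -- Eventually `γ n ≤ 0`, and j log log n is at most a tenth of log n.
  have ht : ∀ᶠ n : ℕ in atTop, n * q n ≤ 11 / 10 * Real.log n := by
    have h1 := (Real.isLittleO_log_id_atTop.comp_tendsto hlog).bound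
      (show (0 : ℝ) < 1 / (10 * (j + 1)) by positivity)
    filter_upwards [h1, hlim.eventually_le_atBot 0, eventually_ge_atTop 2,
      hlog.eventually_ge_atTop 1] with n h1 h2 hn hL
    simp only [Function.comp, id, Real.norm_eq_abs] at h1
    rw [abs_of_nonneg (Real.log_nonneg hL), abs_of_nonneg (by linarith : 0 ≤ Real.log n)] at h1
    have h3 : (j : ℝ) * Real.log (Real.log n) ≤ 1 / 10 * Real.log n := by
      calc (j : ℝ) * Real.log (Real.log n) ≤ (j + 1) * (1 / (10 * (j + 1)) * Real.log n) := by
            have := Real.log_nonneg hL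
            gcongr
            linarith
        _ = _ := by field_simp
    rw [hγ n hn]
    linarith
  have hnq : Tendsto (fun n : ℕ => n * q n ^ 2) atTop (𝓝 0) := by
    have hbound : ∀ᶠ n : ℕ in atTop,
        n * q n ^ 2 ≤ 4 * (Real.log n ^ 2 * Real.exp (-(1 * Real.log n))) := by
      filter_upwards [ht, eventually_ge_atTop 2, hlog.eventually_ge_atTop 1] with n h1 hn hL
      have hn0 : (0 : ℝ) < n := by exact_mod_cast (by omega : 0 < n)
      rw [one_mul, Real.exp_neg, Real.exp_log hn0, ← div_eq_mul_inv, ← mul_div_assoc,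
        le_div_iff₀ hn0]
      have h2 : 0 ≤ n * q n := mul_nonneg hn0.le (hq0 n)
      calc n * q n ^ 2 * n = (n * q n) ^ 2 := by ring
        _ ≤ (2 * Real.log n) ^ 2 := pow_le_pow_left₀ h2 (by linarith) 2
        _ = _ := by ring
    have hz := (((tendsto_pow_mul_exp_neg_mul 2 one_pos).comp hlog).const_mul 4)
    rw [mul_zero] at hz
    exact squeeze_zero' (Eventually.of_forall fun n => mul_nonneg n.cast_nonneg (sq_nonneg _))
      hbound hz
  have hCnq : Tendsto (fun n : ℕ => n * (C * q n ^ 2)) atTop (𝓝 0) := by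
    have := hnq.const_mul C
    rw [mul_zero] at this
    exact this.congr fun n => by ring
  set k := j + 1 with hk
  -- Only the first summand, from disjoint rings, survives in the limit, and it tends to 1.
  set B : ℕ → ℝ := fun n => correlationBound k (n * (C * q n ^ 2)) (q n) +
    ((C * lam n + 2 * (C * lam n) ^ 2) * (4 ^ (k + 1) * Real.exp (10 / 3) * 7 ^ k) +
        2 * C * 4 ^ (k + 1) * Real.exp (10 / 9) * 7 ^ k *
          (Real.log n ^ (k + 2) * Real.exp (-(7 / 18 * Real.log n))) +
        8 * C ^ 2 * 4 ^ (k + 1) * 7 ^ k *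
          (Real.log n ^ (k + 4) * Real.exp (-(7 / 18 * Real.log n)))) with hB
  have hB_lim : Tendsto B atTop (𝓝 1) := by
    have h1 := tendsto_correlationBound k hCnq hq_lim
    have h2 := ((hlam.const_mul C).add (((hlam.const_mul C).pow 2).const_mul 2)).mul_const
      (4 ^ (k + 1) * Real.exp (10 / 3) * 7 ^ k)
    have h3 (s : ℕ) (D : ℝ) := ((tendsto_pow_mul_exp_neg_mul s
      (show (0 : ℝ) < 7 / 18 by norm_num)).comp hlog).const_mul D
    have := h1.add ((h2.add (h3 (k + 2) (2 * C * 4 ^ (k + 1) * Real.exp (10 / 9) * 7 ^ k))).add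
      (h3 (k + 4) (8 * C ^ 2 * 4 ^ (k + 1) * 7 ^ k)))
    simpa using this
  set p : ℕ → ℝ := fun n => μ 0 * binomialLT (n - 1) k (q n) with hp
  set F : ℕ → ℝ := fun n => min (Real.exp (-1) * Real.exp (Real.log n / 2))
      (Real.exp (-1) * Real.exp (-γ n) / (4 ^ j * j.factorial)) with hF
  have hF_lim : Tendsto F atTop atTop := by
    refine Filter.tendsto_atTop.mpr fun b => ?_
    have h1 : Tendsto (fun n : ℕ => Real.exp (-1) * Real.exp (Real.log n / 2)) atTop atTop :=
      (Real.tendsto_exp_atTop.comp (hlog.atTop_div_const two_pos)).const_mul_atTop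
        (Real.exp_pos _)
    have h2 : Tendsto (fun n : ℕ => Real.exp (-1) * Real.exp (-γ n) / (4 ^ j * j.factorial))
        atTop atTop :=
      ((Real.tendsto_exp_atTop.comp (tendsto_neg_atBot_atTop.comp hlim)).const_mul_atTop
        (Real.exp_pos _)).atTop_div_const (by positivity)
    filter_upwards [h1.eventually_ge_atTop b, h2.eventually_ge_atTop b] with n h1 h2
    exact le_min h1 h2
  have hFp : ∀ᶠ n : ℕ in atTop, μ 0 * F n ≤ n * p n := by
    filter_upwards [eventually_ge_atTop (2 * (j + 1)), hlog.eventually_ge_atTop 1,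
      eventually_ge_atTop 2, hq_lim.eventually_le_const (show (0 : ℝ) < 1 / 2 by norm_num),
      hnq.eventually_le_const (show (0 : ℝ) < 1 / 2 by norm_num)] with n hn hL hn2 hq2 hnq2
    have := min_le_mul_binomialLT hn (by linarith) (hq0 n) hq2 (by linarith) (hγ n hn2)
    calc μ 0 * F n ≤ μ 0 * (n * binomialLT (n - 1) k (q n)) :=
          mul_le_mul_of_nonneg_left this (hμ' 0)
      _ = n * p n := by simp only [hp]; ring
  have hnp : Tendsto (fun n : ℕ => n * p n) atTop atTop :=
    tendsto_atTop_mono' _ hFp (hF_lim.const_mul_atTop (hμ 0))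
  have hmain : ∀ᶠ n : ℕ in atTop,
      probMinDegreeGE n μ (K n) (P n) (α n) k ≤ 1 / (n * p n) + B n - 1 := by
    have hCl : Tendsto (fun n => C * lam n) atTop (𝓝 0) := by simpa using hlam.const_mul C
    filter_upwards [eventually_ge_atTop 2, hlog.eventually_ge_atTop 1, ht,
      hq_lim.eventually_le_const (show (0 : ℝ) < 1 / 20 by norm_num),
      hCl.eventually_le_const (show (0 : ℝ) < 1 / 2 by norm_num),
      hCnq.eventually_le_const (show (0 : ℝ) < 1 by norm_num),
      hnp.eventually_gt_atTop 0] with n hn hL htn hq20 hCln hC1 hnp0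
    have hq2 : q n < 1 / 2 := by linarith
    have hn0 : (0 : ℝ) < n := by exact_mod_cast (by omega : 0 < n)
    have hrem := correlation_remainder_le (k := k) hC0 (hlam0 n) (hα0 n) (hα1 n)
      (q := q n) rfl hq20 (by omega) hL htn hC1
    have hR0 := correlationBound_nonneg k (u := n * (C * q n ^ 2)) (by positivity) hq2
    have hBn : 0 ≤ B n := by
      have := hlam0 n
      have : 0 ≤ Real.log n := by linarith
      simp only [hB]
      positivity
    refine probMinDegreeGE_le hμ hμ_sum (hK n hn) (α n) k (by omega) hBn rfl
      (pos_of_mul_pos_right hnp0 hn0.le) fun x y hxy => ?_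
    refine (modelMeasure_real_inter_le_correlationBound hμ hμ_sum (hK n hn) (hK_two n hn) (α n) k
      ((shareProb_le_mul_meanShareProb hμ _ _).trans hCln) hxy hC_def rfl rfl hq2).trans ?_
    refine mul_le_mul_of_nonneg_left ?_ (sq_nonneg _)
    simp only [hB]
    linarith
  have hup : Tendsto (fun n : ℕ => 1 / (n * p n) + B n - 1) atTop (𝓝 0) := by
    have h1 : Tendsto (fun n : ℕ => 1 / (n * p n)) atTop (𝓝 0) :=
      hnp.inv_tendsto_atTop.congr fun n => (one_div _).symm
    simpa using (h1.add hB_lim).sub_const 1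
  exact squeeze_zero' (Eventually.of_forall fun n => measureReal_nonneg) hmain hup

end HeteroKeyGraph

end

/-! ### The theorem. -/

theorem theorem1
    -- the number of classes (class `1` is the index `0`) and the class probabilities
    (r : ℕ) [NeZero r] (μ : Fin r → ℝ) (hμ_pos : ∀ i, 0 < μ i) (hμ_sum : ∑ i, μ i = 1)
    -- the scaling of the key ring sizes, the key pool size and the channel probability
    (K : ℕ → Fin r → ℕ) (P : ℕ → ℕ) (α : ℕ → unitInterval)
    (hK_two : ∀ n, 2 ≤ n → 2 ≤ K n 0)
    (hK_mono : ∀ n, 2 ≤ n → Monotone (K n))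
    (hK_pool : ∀ n, 2 ≤ n → ∀ i, (K n i : ℝ) ≤ (P n : ℝ) / 2)
    (hα : ∀ n, 0 < (α n : ℝ) ∧ (α n : ℝ) < 1)
    (k : ℕ) (γ : ℕ → ℝ)
    (hγ : ∀ n : ℕ, 2 ≤ n →
      (α n : ℝ) * HeteroKeyGraph.meanEdgeProb μ (K n) (P n) 0 =
        (Real.log n + ((k : ℝ) - 1) * Real.log (Real.log n) + γ n) / n) :
    (1 ≤ k →
      Tendsto (fun n => HeteroKeyGraph.meanEdgeProb μ (K n) (P n) 0) atTop (𝓝 0) →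
      Tendsto γ atTop atBot →
      Tendsto (fun n => HeteroKeyGraph.probMinDegreeGE n μ (K n) (P n) (α n) k) atTop (𝓝 0)) ∧
    (Tendsto γ atTop atTop →
      Tendsto (fun n => HeteroKeyGraph.probMinDegreeGE n μ (K n) (P n) (α n) k) atTop (𝓝 1)) := by
  have hK : ∀ n, 2 ≤ n → ∀ i, K n i ≤ P n := fun n hn i => by
    have h := hK_pool n hn i
    have h0 : (0 : ℝ) ≤ P n := Nat.cast_nonneg _
    exact_mod_cast (by linarith : (K n i : ℝ) ≤ P n)
  have hγ' (j : ℕ) (hj : k = j + 1) (n : ℕ) (hn : 2 ≤ n) :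
      n * ((α n : ℝ) * HeteroKeyGraph.meanShareProb μ (K n) (P n) (K n 0)) =
        Real.log n + j * Real.log (Real.log n) + γ n := by
    have hn0 : (n : ℝ) ≠ 0 := by exact_mod_cast (by omega : n ≠ 0)
    have h := hγ n hn
    rw [eq_div_iff hn0, hj] at h
    push_cast at h
    rw [add_sub_cancel_right] at h
    rw [← h, mul_comm]
    rfl
  refine ⟨fun hk hlam hlim => ?_, fun hlim => ?_⟩
  · obtain ⟨j, rfl⟩ : ∃ j, k = j + 1 := ⟨k - 1, by omega⟩
    exact HeteroKeyGraph.tendsto_probMinDegreeGE_zero hμ_pos hμ_sum hK_two hK j (hγ' j rfl) hlam hlim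
  · rcases Nat.eq_zero_or_pos k with rfl | hk
    -- For k = 0 the event is the whole space, which has mass 1 once n ≥ 2 makes the parameters
    -- admissible.
    · refine tendsto_const_nhds.congr' ?_
      filter_upwards [eventually_ge_atTop 2] with n hn
      have := HeteroKeyGraph.isProbabilityMeasure_modelMeasure (n := n) (fun i => (hμ_pos i).le)
        hμ_sum (hK n hn) (α n)
      simp [HeteroKeyGraph.probMinDegreeGE]
    · obtain ⟨j, rfl⟩ : ∃ j, k = j + 1 := ⟨k - 1, by omega⟩
      exact HeteroKeyGraph.tendsto_probMinDegreeGE_one hμ_pos hμ_sum hK_mono hK j (hγ' j rfl) hlim
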